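/- **Setting.** A cloud server holds $N$ files of $F$ bits and serves a set $\mathcal K$ of $K\le N$ F-APs, each with a cache of $MF$ bits, $0<M<N$. *Placement:* for every file, each F-AP independently caches a uniformly random set of $\lfloor MF/N\rfloor$ of its $F$ bits. *Requests:* time is divided into slots $1,\dots,B$; each F-AP $k$ requests one file $d_k$ in one slot, $\mathcal U_b$ is the set of F-APs whose request arrives in slot $b$, and the maximum request delay is $\Delta b\in\{1,\dots,B\}$ slots. Let $W_{k,T}$ be the string of those bits of file $d_k$ that are cached at all F-APs in $T$ and at no others, and let $\mathcal U^{\rm a}_b=\bigcup_{i=\max\{1,b-\Delta b+1\}}^{b}\mathcal U_i$. *Delivery:* if $\Delta b<B$, nothing is sent at the end of slots $b<\Delta b$. At the end of a slot $b$ with $\Delta b\le b<B$, for every $S\subseteq\mathcal K$ meeting $\mathcal U_{b-\Delta b+1}$, the server sends $\bigoplus_{k\in S\cap\mathcal U^{\rm a}_b}W_{k,S\setminus\{k\}}$ (shorter strings zero-padded), unless one of these subfiles is currently $\varnothing$. At the end of slot $B$ it sends this XOR for every $S$ meeting $\mathcal U^{\rm a}_B$. Every subfile that has been sent is set to $\varnothing$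 at the end of that slot. If $\Delta b=B$, nothing is sent before the end of slot $B$, when $\bigoplus_{k\in S}W_{k,S\setminus\{k\}}$ is sent for every nonempty $S$. The *fronthaul load* is the total number of bits sent. *Partition algorithm.* A nonempty $S\subseteq\mathcal K$ is partitioned as follows. Let $\gamma$ be the last slot in which a request of $S$ arrives. While $S\neq\varnothing$, let $\beta+1$ be the first slot with $\mathcal U_{\beta+1}\cap S\ne\varnothing$, and split off from $S$ the subset of the F-APs whose requests arrive in slots $\beta+1,\dots,\min\{\beta+\Delta b,\gamma\}$. Let $\eta_S(\Delta b)$ be the number of subsets obtained. **Theorem 1.** Suppose that $|\mathcal U_b|=L\ge1$ for every slot $b\in\{1,\dots,B\}$ (so $K=BL$) and $B\ge3$. Then: (i) for $1\le s\le K$ and $\left\lceil\frac{s}{\Delta b\,L}\right\rceil\le Y\le\min\{\lceil B/\Delta b\rceil,s\}$, the number of $S\subseteq\mathcal K$ with $|S|=s$ and $\eta_S(\Delta b)=Y$ equals $q(s,Y,\Delta b)$; (ii) as $F\to\infty$, the fronthaul load divided by $F$ converges in probability, uniformly over all requests $(d_k)$ and all file contents (in particular in the worst case), to $$\frac{R_A(M,N,K,\Delta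 b)}{F}=\sum_{s=1}^{K}\Big(\frac MN\Big)^{s-1}\Big(1-\frac MN\Big)^{K-(s-1)}\sum_{Y=\lceil s/(\Delta b\, L)\rceil}^{\min\{\lceil B/\Delta b\rceil,\,s\}}q(s,Y,\Delta b)\,Y .$$ Here, with $m=\max\left\{\left\lceil\frac{s-(Y-1)\Delta b\,L}{L}\right\rceil,1\right\}$, and taking the first case that applies, $$q(s,Y,\Delta b)=\begin{cases}\binom Ks,&\Delta b=B,\\ q_2(s,Y,\Delta b),&\Delta b=1,\\ q_2(s,Y,\Delta b),&\Delta b=m<B,\\ \sum_{\Delta b'=m}^{\Delta b-1}q_1(s,Y,\Delta b',\Delta b)+q_2(s,Y,\Delta b),& m<\Delta b\le B-(Y-1)\Delta b,\\ \sum_{\Delta b'=m}^{B-(Y-1)\Delta b}q_1(s,Y,\Delta b',\Delta b),& B-(Y-1)\Delta b<\Delta b<B,\end{cases}$$ $$q_1(s,Y,\Delta b',\Delta b)=\binom{B-\Delta b'-(Y-1)(\Delta b-1)}{Y-1}\sum_{\alpha=\max\{Y,\,s-((Y-1)\Delta b+\Delta b'-Y)L\}}^{\min\{s,YL\}}b(Y,\alpha)\binom{((Y-1)\Delta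 b+\Delta b'-Y)L}{s-\alpha},$$ $$q_2(s,Y,1)=\binom BY b(Y,s),$$ $$q_2(s,Y,\Delta b)=\binom{B-Y(\Delta b-1)}{Y}\sum_{\alpha=\max\{Y,\,s-Y(\Delta b-1)L\}}^{\min\{s,YL\}}b(Y,\alpha)\binom{Y(\Delta b-1)L}{s-\alpha}\qquad(1<\Delta b<B),$$ and, for $1\le Y\le\alpha\le YL$ (with $b(Y,\alpha)=0$ for other $\alpha$ when $Y=1$), $$b(Y,\alpha)=\begin{cases}\binom L\alpha,&Y=1,\\ \binom L1^{Y},&Y>1,\ \alpha=Y,\\ 1,&Y>1,\ L>1,\ \alpha=YL,\\ \sum_{v=1}^{\min\{L,\alpha-(Y-1)\}}\binom Lv\,b(Y-1,\alpha-v),&\text{otherwise; this sum also defines } b(Y,\alpha) \text{ for } Y>1,\ \alpha>YL.\end{cases}$$ -/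

import Mathlib

namespace AsyncCaching

/-! ### Arrivals of requests

There are `K` F-APs, indexed by `Fin K`, and `B` time slots, numbered `1, …, B`. Each F-AP makes
exactly one request; `slot k` is the number of the time slot in which F-AP `k` makes it. -/

/-- The set `U_b` of the F-APs whose requests arrive during time slot `b`. -/
def arrivals {K : ℕ} (slot : Fin K → ℕ) (b : ℕ) : Finset (Fin K) :=
  Finset.univ.filter fun k => slot k = b

/-- The set `U^a = ⋃_{i = max (1, b - Δb + 1)}^{b} U_i` of the F-APs active during time slot `b`. -/
def active {K : ℕ} (slot : Fin K → ℕ) (Δb b : ℕ) : Finset (Fin K) :=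
  (Finset.Icc (max 1 (b + 1 - Δb)) b).biUnion (arrivals slot)

/-! ### The encoding set partition algorithm -/

/-- The main loop of the partition algorithm, where `γ` is the last slot of the active interval of
the original encoding set. The remaining set is `S`. The inner loop of the algorithm advances `β`
until `U_{β+1}` meets `S`; since everything in earlier slots has already been removed from `S`, this
is the `β` for which `β + 1` is the least arrival slot in `S`. The first argument bounds the number
of passes (every pass removes at least one element if `Δb ≥ 1`). -/
def partitionLoop {K : ℕ} (slot : Fin K → ℕ) (Δb γ : ℕ) :
    ℕ → Finset (Fin K) → List (Finset (Fin K))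
  | 0, _ => []
  | n + 1, S =>
    if h : S.Nonempty then
      let β := S.inf' h slot - 1
      let P := if Δb ≤ γ - β
        then S ∩ (Finset.Icc (β + 1) (β + Δb)).biUnion (arrivals slot)
        else S ∩ (Finset.Icc (β + 1) γ).biUnion (arrivals slot)
      P :: partitionLoop slot Δb γ n (S \ P)
    else []

/-- The encoding subsets into which the algorithm partitions the encoding set `S`. -/
def partitionSets {K : ℕ} (slot : Fin K → ℕ) (Δb : ℕ) (S : Finset (Fin K)) :
    List (Finset (Fin K)) :=
  partitionLoop slot Δb (S.sup slot) S.card S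

/-- `η_S(Δb)`, the number of encoding subsets into which `S` is partitioned. -/
def eta {K : ℕ} (slot : Fin K → ℕ) (Δb : ℕ) (S : Finset (Fin K)) : ℕ :=
  (partitionSets slot Δb S).length

/-! ### The delivery phase -/

/-- The data on which the delivery phase runs: the number `B` of slots, the maximum request delay
`Δb`, the arrival slots, the cache contents (`cache k n` is the set of the positions of the bits of
file `n` stored by F-AP `k`), the requests `d_k`, and the `N` files of `F` bits each. -/
structure Delivery (K N F : ℕ) where
  B : ℕ
  Δb : ℕ
  slot : Fin K → ℕ
  cache : Fin K → Fin N → Finset (Fin F)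
  demand : Fin K → Fin N
  file : Fin N → Fin F → Bool

/-- Bitwise XOR of two bit strings, the shorter one being padded with zeros. -/
def xorPad : List Bool → List Bool → List Bool
  | [], m => m
  | l, [] => l
  | a :: l, c :: m => xor a c :: xorPad l m

namespace Delivery

variable {K N F : ℕ} (D : Delivery K N F)

/-- The subfile `W_{k,T}` before any transmission: the bits of the file requested by F-AP `k` which
are cached at all the F-APs in `T` and at no other F-AP. -/
def subfile (k : Fin K) (T : Finset (Fin K)) : List Bool :=
  ((Finset.univ.filter fun i : Fin F =>
      ∀ j : Fin K, i ∈ D.cache j (D.demand k) ↔ j ∈ T).sort (· ≤ ·)).map (D.file (D.demand k))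

/-- The current subfile: the subfiles listed in `done` have been delivered and set to `∅`. -/
def currentSubfile (done : Finset (Fin K × Finset (Fin K))) (k : Fin K) (T : Finset (Fin K)) :
    List Bool :=
  if (k, T) ∈ done then [] else D.subfile k T

/-- The encoding sets `S = S¹ ∪ S²` for which a coded-multicasting content is transmitted at the end
of slot `b`. For `Δb ≤ b < B` the content for `S` is transmitted if `S` meets `U_{b-Δb+1}`, unless
one of the subfiles to be encoded is currently `∅`. At the end of slot `B` it is transmitted for all
`S` that meet `U^a`. If `Δb = B`, everything is transmitted at the end of slot `B`. -/
def sentSets (b : ℕ) (done : Finset (Fin K × Finset (Fin K))) : Finset (Finset (Fin K)) :=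
  if D.Δb < D.B then
    if b ≤ D.Δb - 1 then ∅
    else if b < D.B then
      Finset.univ.filter fun S =>
        (S ∩ arrivals D.slot (b + 1 - D.Δb)).Nonempty ∧
          ∀ k ∈ S ∩ active D.slot D.Δb b, D.currentSubfile done k (S.erase k) ≠ []
    else Finset.univ.filter fun S => (S ∩ active D.slot D.Δb b).Nonempty
  else if b ≤ D.B - 1 then ∅
  else Finset.univ.filter fun S => S.Nonempty

/-- The content `⊕_{k ∈ S ∩ U^a} W_{k, S \ {k}}` formed for `S` in slot `b`. -/
def message (b : ℕ) (done : Finset (Fin K × Finset (Fin K))) (S : Finset (Fin K)) : List Bool :=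
  ((S ∩ active D.slot D.Δb b).sort (· ≤ ·)).foldr
    (fun k m => xorPad (D.currentSubfile done k (S.erase k)) m) []

/-- The pairs `(k, T)` such that `W_{k,T}` has been delivered by the end of slot `b`. (For different
`S` the contents involve different subfiles, so the order in which the sets `S` are treated within a
slot is irrelevant.) -/
def delivered : ℕ → Finset (Fin K × Finset (Fin K))
  | 0 => ∅
  | b + 1 => delivered b ∪ (D.sentSets (b + 1) (delivered b)).biUnion fun S =>
      (S ∩ active D.slot D.Δb (b + 1)).image fun k => (k, S.erase k)

/-- The fronthaul load: the total number of bits transmitted at the ends of the slots `1, …, B`. -/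
def load : ℕ :=
  ∑ b ∈ Finset.Icc 1 D.B, ∑ S ∈ D.sentSets b (D.delivered (b - 1)),
    (D.message b (D.delivered (b - 1)) S).length

end Delivery

/-! ### The random placement -/

/-- The outcomes of the placement phase: each of the `K` F-APs stores exactly `m` of the `F` bits
of each of the `N` files. -/
abbrev Placement (K N F m : ℕ) : Type :=
  Fin K → Fin N → {A : Finset (Fin F) // A.card = m}

open Classical in
/-- The probability of the event `E` when all the sets of `m` cached bits are chosen uniformly at
random, independently over the F-APs and the files; that is, when the placement is uniformly
distributed on the (finite) product of the sets of possible choices. -/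
noncomputable def placementProb {K N F m : ℕ} (E : Placement K N F m → Prop) : ℝ :=
  ((Finset.univ.filter E).card : ℝ) / (Fintype.card (Placement K N F m) : ℝ)

/-! ### The closed form

In the range of the variables in which the following expressions are used in `loadFormula`, no
subtraction of natural numbers below gives a negative number, except in lower summation limits of
the form `max {Y, ·}` or `max {·, 1}`, where truncation at `0` makes no difference. -/

/-- `b(Y, α)` for `Y ≤ α ≤ Y L`, and `0` for other `α`. -/
def bCount (L : ℕ) : ℕ → ℕ → ℕ
  | 0, _ => 0
  | 1, α => if 1 ≤ α ∧ α ≤ L then L.choose α else 0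
  | Y + 2, α =>
    if α = Y + 2 then (L.choose 1) ^ (Y + 2)
    else if 1 < L ∧ α = (Y + 2) * L then 1
    else ∑ v ∈ Finset.Icc 1 (min L (α - (Y + 1))), L.choose v * bCount L (Y + 1) (α - v)

/-- `q₁(s, Y, Δb', Δb)`. -/
def q₁ (B L s Y Δb' Δb : ℕ) : ℕ :=
  (B - Δb' - (Y - 1) * (Δb - 1)).choose (Y - 1) *
    ∑ α ∈ Finset.Icc (max Y (s - ((Y - 1) * Δb + Δb' - Y) * L)) (min s (Y * L)),
      bCount L Y α * (((Y - 1) * Δb + Δb' - Y) * L).choose (s - α)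

/-- `q₂(s, Y, Δb)`. -/
def q₂ (B L s Y Δb : ℕ) : ℕ :=
  if Δb = 1 then B.choose Y * bCount L Y s
  else (B - Y * (Δb - 1)).choose Y *
    ∑ α ∈ Finset.Icc (max Y (s - Y * (Δb - 1) * L)) (min s (Y * L)),
      bCount L Y α * (Y * (Δb - 1) * L).choose (s - α)

/-- `max {⌈(s - (Y - 1) Δb L) / L⌉, 1}`, the least possible number of slots of the last of the `Y`
big time slots, when each of the other ones has `Δb` slots with `L` arrivals each. -/
def minLast (L s Y Δb : ℕ) : ℕ :=
  max ⌈((s : ℚ) - ((Y : ℚ) - 1) * Δb * L) / L⌉₊ 1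

/-- `q(s, Y, Δb)`. -/
def q (K B L s Y Δb : ℕ) : ℕ :=
  if Δb = B then K.choose s
  else if Δb = 1 then q₂ B L s Y Δb
  else if Δb = minLast L s Y Δb ∧ Δb < B then q₂ B L s Y Δb
  else if minLast L s Y Δb < Δb ∧ Δb ≤ B - (Y - 1) * Δb then
    (∑ Δb' ∈ Finset.Icc (minLast L s Y Δb) (Δb - 1), q₁ B L s Y Δb' Δb) + q₂ B L s Y Δb
  else if B - (Y - 1) * Δb < Δb ∧ Δb < B then
    ∑ Δb' ∈ Finset.Icc (minLast L s Y Δb) (B - (Y - 1) * Δb), q₁ B L s Y Δb' Δb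
  else 0

/-- The range `{⌈s / (Δb L)⌉, …, min {⌈B / Δb⌉, s}}` of the number `Y` of encoding subsets. -/
def rangeY (B L s Δb : ℕ) : Finset ℕ :=
  Finset.Icc ⌈(s : ℚ) / (Δb * L)⌉₊ (min ⌈(B : ℚ) / Δb⌉₊ s)

/-- The closed form `R_A(M, N, K, Δb)` of the fronthaul load, divided by the file size `F`. Here
`(M/N)^(s-1) (1-M/N)^(K-(s-1))` is the asymptotic value of `|W_{k, S \ {k}}| / F` for `|S| = s`. -/
noncomputable def loadFormula (M : ℝ) (N K B L Δb : ℕ) : ℝ :=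
  ∑ s ∈ Finset.Icc 1 K, (M / N) ^ (s - 1) * (1 - M / N) ^ (K - (s - 1)) *
    ∑ Y ∈ rangeY B L s Δb, (q K B L s Y Δb : ℝ) * Y

end AsyncCaching

/-! Fix an encoding set `S`. Its messages involve only the subfiles `W_{k, S \ {k}}`, which occur
for no other encoding set, so each `S` can be followed on its own. Before slot `B`, a message for
`S` is triggered exactly when its oldest undelivered request reaches its deadline, and it serves
every request of `S` that has arrived by then. These are the requests that one pass of the partition
algorithm cuts off. Whatever remains at slot `B` fits into one last pass. Hence `S` costs exactly
`eta` nonempty messages, provided that none of its subfiles is empty at the outset (`exists_state`,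
`sum_sentBits_bounds`).

A message is as long as its longest subfile. With `x = M/N` and `s = |S|`, all the subfiles involved
have about `F x^(s-1) (1-x)^(K-(s-1))` bits. This follows from exact first and second moments and
Chebyshev's inequality (`placementProb_deviation_le`). A union bound over the finitely many pairs of
a file and a set of F-APs gives uniformity, since neither requests nor file contents enter these
events.

It remains to count the sets with `eta = Y`. Conditioning on whether `S` meets the first slot gives
a recursion for a generating polynomial (`etaPoly_succ`). Its solution `etaClosed` places `Y`
disjoint windows of `Δb` slots: the first slot of each must be met, giving a factor `(1 + X)^L - 1`,
and every other slot of a window is free, giving `(1 + X)^L`. The last window may be cut short by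
the end of slot `B`. Complete windows yield `q₂`, truncated ones `q₁`, and the summation limits in
`q` only omit zero terms (`q_eq_of_lt`). -/

namespace AsyncCaching

/-! ### The partition algorithm: recursion and bounds for `eta` -/

section Partition

variable {K : ℕ} {slot : Fin K → ℕ} {Δb : ℕ}

theorem mem_biUnion_arrivals {a b : ℕ} {k : Fin K} :
    k ∈ (Finset.Icc a b).biUnion (arrivals slot) ↔ a ≤ slot k ∧ slot k ≤ b := by
  simp [arrivals]

/-- One pass of the partition algorithm splits off the requests of the first `Δb` slots. -/
theorem partitionLoop_succ {γ n a : ℕ} {S : Finset (Fin K)} (ha : 1 ≤ a)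
    (hle : ∀ k ∈ S, a ≤ slot k) (hex : ∃ k ∈ S, slot k = a) (hγ : ∀ k ∈ S, slot k ≤ γ) :
    partitionLoop slot Δb γ (n + 1) S =
      S.filter (fun k => slot k < a + Δb) ::
        partitionLoop slot Δb γ n (S.filter fun k => a + Δb ≤ slot k) := by
  obtain ⟨k₀, hk₀, hk₀a⟩ := hex
  have hS : S.Nonempty := ⟨k₀, hk₀⟩
  have hinf : S.inf' hS slot = a := by
    apply le_antisymm
    · rw [← hk₀a]; exact Finset.inf'_le _ hk₀
    · exact Finset.le_inf' _ _ hle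
  -- Both branches agree with the untruncated window, because no element of `S` lies beyond `γ`.
  have hP : (if Δb ≤ γ - (a - 1)
        then S ∩ (Finset.Icc (a - 1 + 1) (a - 1 + Δb)).biUnion (arrivals slot)
        else S ∩ (Finset.Icc (a - 1 + 1) γ).biUnion (arrivals slot)) =
      S.filter (fun k => slot k < a + Δb) := by
    split_ifs with h <;> ext k <;>
      simp only [Finset.mem_inter, mem_biUnion_arrivals, Finset.mem_filter] <;>
      refine and_congr_right fun hk => ?_
    · have := hle k hk
      omega
    · have := hle k hk
      have := hγ k hk
      omega
  rw [partitionLoop, dif_pos hS]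
  simp only [hinf, hP]
  congr 2
  ext k
  simp only [Finset.mem_sdiff, Finset.mem_filter]
  constructor
  · rintro ⟨h1, h2⟩
    exact ⟨h1, not_lt.1 fun h => h2 ⟨h1, h⟩⟩
  · rintro ⟨h1, h2⟩
    exact ⟨h1, fun h => by omega⟩

theorem exists_least_slot {S : Finset (Fin K)} (hS : S.Nonempty) :
    ∃ k ∈ S, ∀ j ∈ S, slot k ≤ slot j :=
  Finset.exists_min_image S slot hS

theorem card_filter_late_lt (hΔ : 1 ≤ Δb) {S : Finset (Fin K)} {a : ℕ}
    (hex : ∃ k ∈ S, slot k = a) :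
    (S.filter fun k => a + Δb ≤ slot k).card < S.card := by
  obtain ⟨k, hk, rfl⟩ := hex
  apply Finset.card_lt_card
  rw [Finset.filter_ssubset]
  exact ⟨k, hk, by omega⟩

theorem partitionLoop_empty (γ n : ℕ) : partitionLoop slot Δb γ n ∅ = [] := by
  cases n <;> simp [partitionLoop]

/-- The result of the algorithm depends neither on the bound on the number of passes nor on the end
of the active interval, as long as these are large enough. -/
theorem partitionLoop_congr (hΔ : 1 ≤ Δb) (hpos : ∀ k, 1 ≤ slot k) {γ γ' : ℕ} (n : ℕ) :
    ∀ (n' : ℕ) (S : Finset (Fin K)), S.card ≤ n → S.card ≤ n' → (∀ k ∈ S, slot k ≤ γ) →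
      (∀ k ∈ S, slot k ≤ γ') →
      partitionLoop slot Δb γ n S = partitionLoop slot Δb γ' n' S := by
  induction n with
  | zero =>
    intro n' S h _ _ _
    obtain rfl : S = ∅ := by simpa using h
    simp [partitionLoop_empty]
  | succ n ih =>
    intro n' S h h' hγ hγ'
    rcases S.eq_empty_or_nonempty with rfl | hS
    · simp [partitionLoop_empty]
    obtain ⟨k, hk, hmin⟩ := exists_least_slot (slot := slot) hS
    obtain ⟨n', rfl⟩ : ∃ l, n' = l + 1 :=
      Nat.exists_eq_add_one.2 (lt_of_lt_of_le hS.card_pos h')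
    have hlt := card_filter_late_lt (slot := slot) hΔ ⟨k, hk, rfl⟩
    rw [partitionLoop_succ (hpos k) hmin ⟨k, hk, rfl⟩ hγ,
      partitionLoop_succ (hpos k) hmin ⟨k, hk, rfl⟩ hγ',
      ih n' _ (by omega) (by omega) (fun j hj => hγ j (Finset.mem_filter.1 hj).1)
        (fun j hj => hγ' j (Finset.mem_filter.1 hj).1)]

@[simp] theorem eta_empty : eta slot Δb ∅ = 0 := by
  simp [eta, partitionSets, partitionLoop_empty]

/-- Together with `eta_empty`, this recursion, free of the pass bound and of `γ`, is all that later
arguments use about the algorithm. -/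
theorem eta_step (hΔ : 1 ≤ Δb) (hpos : ∀ k, 1 ≤ slot k) {S : Finset (Fin K)} {a : ℕ}
    (hle : ∀ k ∈ S, a ≤ slot k) (hex : ∃ k ∈ S, slot k = a) :
    eta slot Δb S = eta slot Δb (S.filter fun k => a + Δb ≤ slot k) + 1 := by
  have ha : 1 ≤ a := by
    obtain ⟨k, _, rfl⟩ := hex
    exact hpos k
  have hlt := card_filter_late_lt (slot := slot) hΔ hex
  have hsup : ∀ k ∈ S, slot k ≤ S.sup slot := fun k hk => Finset.le_sup hk
  obtain ⟨n, hn⟩ : ∃ l, S.card = l + 1 := Nat.exists_eq_add_one.2 (by omega)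
  rw [eta, partitionSets, hn, partitionLoop_succ ha hle hex hsup, List.length_cons, eta,
    partitionSets]
  congr 2
  exact partitionLoop_congr hΔ hpos n _ _ (by omega) le_rfl
    (fun j hj => hsup j (Finset.mem_filter.1 hj).1) (fun j hj => Finset.le_sup hj)

theorem eta_le_card (hΔ : 1 ≤ Δb) (hpos : ∀ k, 1 ≤ slot k) (S : Finset (Fin K)) :
    eta slot Δb S ≤ S.card := by
  induction S using Finset.strongInduction with
  | H S ih =>
    rcases S.eq_empty_or_nonempty with rfl | hS
    · simp
    obtain ⟨k, hk, hmin⟩ := exists_least_slot (slot := slot) hS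
    have hlt := card_filter_late_lt (slot := slot) hΔ ⟨k, hk, rfl⟩
    rw [eta_step hΔ hpos hmin ⟨k, hk, rfl⟩]
    have := ih (S.filter fun j => slot k + Δb ≤ slot j)
      ((Finset.filter_ssubset).2 ⟨k, hk, by omega⟩)
    omega

theorem eta_pos (hΔ : 1 ≤ Δb) (hpos : ∀ k, 1 ≤ slot k) {S : Finset (Fin K)} (hS : S.Nonempty) :
    1 ≤ eta slot Δb S := by
  obtain ⟨k, hk, hmin⟩ := exists_least_slot (slot := slot) hS
  rw [eta_step hΔ hpos hmin ⟨k, hk, rfl⟩]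
  omega

theorem eta_eq_one (hΔ : 1 ≤ Δb) (hpos : ∀ k, 1 ≤ slot k) {S : Finset (Fin K)} (hS : S.Nonempty)
    {b : ℕ} (h : ∀ k ∈ S, b < slot k ∧ slot k ≤ b + Δb) : eta slot Δb S = 1 := by
  obtain ⟨k, hk, hmin⟩ := exists_least_slot (slot := slot) hS
  rw [eta_step hΔ hpos hmin ⟨k, hk, rfl⟩, Finset.filter_eq_empty_iff.2, eta_empty]
  intro j hj
  have := h j hj
  have := h k hk
  omega

/-- Consecutive passes start at least `Δb` slots apart and the last starts no later than slot `B`.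
The offset `a` makes the induction go through. -/
theorem eta_mul_le (hΔ : 1 ≤ Δb) (hpos : ∀ k, 1 ≤ slot k) {B : ℕ} (hB : ∀ k, slot k ≤ B)
    (S : Finset (Fin K)) (a : ℕ) (haB : a ≤ B) (ha : ∀ k ∈ S, a < slot k) :
    eta slot Δb S * Δb + a < B + Δb := by
  induction S using Finset.strongInduction generalizing a with
  | H S ih =>
    rcases S.eq_empty_or_nonempty with rfl | hS
    · simp; omega
    obtain ⟨k, hk, hmin⟩ := exists_least_slot (slot := slot) hS
    rw [eta_step hΔ hpos hmin ⟨k, hk, rfl⟩]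
    have hak := ha k hk
    have hkB := hB k
    by_cases hne : (S.filter fun j => slot k + Δb ≤ slot j).Nonempty
    · obtain ⟨j, hj⟩ := hne
      have hj' := (Finset.mem_filter.1 hj).2
      have := hB j
      have := ih (S.filter fun j => slot k + Δb ≤ slot j)
        ((Finset.filter_ssubset).2 ⟨k, hk, by omega⟩) (slot k + Δb - 1) (by omega)
        (fun j hj => by have := (Finset.mem_filter.1 hj).2; omega)
      rw [Nat.add_mul]
      omega
    · rw [Finset.not_nonempty_iff_eq_empty.1 hne, eta_empty]
      omega

theorem card_window {L B : ℕ}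
    (harr : ∀ b ∈ Finset.Icc 1 B, (arrivals slot b).card = L) (a n : ℕ) (h : a + n ≤ B) :
    (Finset.univ.filter fun k => a < slot k ∧ slot k ≤ a + n).card = n * L := by
  induction n with
  | zero =>
    rw [Nat.zero_mul, Finset.card_eq_zero, Finset.filter_eq_empty_iff]
    intro k _
    omega
  | succ n ih =>
    have : (Finset.univ.filter fun k => a < slot k ∧ slot k ≤ a + (n + 1)) =
        (Finset.univ.filter fun k => a < slot k ∧ slot k ≤ a + n) ∪ arrivals slot (a + n + 1) := by
      ext k
      simp only [arrivals, Finset.mem_filter, Finset.mem_univ, true_and, Finset.mem_union]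
      omega
    rw [this, Finset.card_union_of_disjoint, ih (by omega),
      harr _ (Finset.mem_Icc.2 ⟨by omega, by omega⟩), Nat.succ_mul]
    rw [Finset.disjoint_left]
    intro k
    simp only [arrivals, Finset.mem_filter, Finset.mem_univ, true_and]
    omega

theorem card_window_le {L B : ℕ} (hslot : ∀ k, slot k ∈ Finset.Icc 1 B)
    (harr : ∀ b ∈ Finset.Icc 1 B, (arrivals slot b).card = L) (a n : ℕ) :
    (Finset.univ.filter fun k => a < slot k ∧ slot k ≤ a + n).card ≤ n * L := by
  induction n with
  | zero =>
    rw [Nat.zero_mul, Nat.le_zero, Finset.card_eq_zero, Finset.filter_eq_empty_iff]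
    intro k _
    omega
  | succ n ih =>
    by_cases h : a + (n + 1) ≤ B
    · exact (card_window harr a (n + 1) h).le
    · refine le_trans (Finset.card_le_card fun k => ?_) (ih.trans (Nat.mul_le_mul_right L (Nat.le_succ n)))
      have := (Finset.mem_Icc.1 (hslot k)).2
      simp only [Finset.mem_filter, Finset.mem_univ, true_and]
      omega

/-- Each pass removes requests from at most `Δb` consecutive slots, hence at most `Δb L` of them. -/
theorem card_le_eta_mul (hΔ : 1 ≤ Δb) {L B : ℕ} (hslot : ∀ k, slot k ∈ Finset.Icc 1 B)
    (harr : ∀ b ∈ Finset.Icc 1 B, (arrivals slot b).card = L) (S : Finset (Fin K)) :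
    S.card ≤ eta slot Δb S * (Δb * L) := by
  have hpos : ∀ k, 1 ≤ slot k := fun k => (Finset.mem_Icc.1 (hslot k)).1
  induction S using Finset.strongInduction with
  | H S ih =>
    rcases S.eq_empty_or_nonempty with rfl | hS
    · simp
    obtain ⟨k, hk, hmin⟩ := exists_least_slot (slot := slot) hS
    rw [eta_step hΔ hpos hmin ⟨k, hk, rfl⟩, Nat.succ_mul,
      ← Finset.card_filter_add_card_filter_not (s := S) (fun j => slot k + Δb ≤ slot j)]
    refine Nat.add_le_add (ih _ ((Finset.filter_ssubset).2 ⟨k, hk, by omega⟩)) ?_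
    refine le_trans (Finset.card_le_card fun j hj => ?_)
      (card_window_le hslot harr (slot k - 1) Δb)
    have := hpos k
    simp only [Finset.mem_filter, Finset.mem_univ, true_and] at hj ⊢
    have := hmin j hj.1
    omega

/-- Ensures that grouping the encoding sets by `Y` in `rangeY` loses none of them. -/
theorem eta_mem_rangeY (hΔ : 1 ≤ Δb) {L B : ℕ} (hL : 1 ≤ L)
    (hslot : ∀ k, slot k ∈ Finset.Icc 1 B)
    (harr : ∀ b ∈ Finset.Icc 1 B, (arrivals slot b).card = L) (S : Finset (Fin K)) :
    eta slot Δb S ∈ rangeY B L S.card Δb := by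
  have hpos : ∀ k, 1 ≤ slot k := fun k => (Finset.mem_Icc.1 (hslot k)).1
  have hΔ' : (0 : ℚ) < Δb := by exact_mod_cast hΔ
  have hL' : (0 : ℚ) < L := by exact_mod_cast hL
  rw [rangeY, Finset.mem_Icc, le_min_iff]
  refine ⟨?_, ?_, eta_le_card hΔ hpos S⟩
  · rw [Nat.ceil_le, div_le_iff₀ (by positivity)]
    exact_mod_cast card_le_eta_mul hΔ hslot harr S
  · have h1 := eta_mul_le hΔ hpos (fun k => (Finset.mem_Icc.1 (hslot k)).2) S 0 (Nat.zero_le _)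
      (fun k _ => hpos k)
    have h2 : (eta slot Δb S * Δb : ℚ) < B + Δb := by exact_mod_cast h1
    have h3 : (eta slot Δb S : ℚ) < B / Δb + 1 := by
      rw [← sub_lt_iff_lt_add, lt_div_iff₀ hΔ']
      linarith
    have h4 : (eta slot Δb S : ℚ) < (⌈(B : ℚ) / Δb⌉₊ : ℚ) + 1 :=
      h3.trans_le (by gcongr; exact Nat.le_ceil _)
    have : eta slot Δb S < ⌈(B : ℚ) / Δb⌉₊ + 1 := by exact_mod_cast h4
    omega

end Partition


/-! ### The delivery phase: one message per pass of the partition algorithm -/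

theorem length_xorPad (l m : List Bool) : (xorPad l m).length = max l.length m.length := by
  induction l generalizing m with
  | nil => simp [xorPad]
  | cons a l ih =>
    cases m with
    | nil => simp [xorPad]
    | cons c m => simp [xorPad, ih]

/-- If the nonempty ones among the strings `f k` have lengths between `lo` and `hi`, so has their
XOR, unless all of them are empty. -/
theorem length_foldr_xorPad {α : Type*} {lo hi : ℝ} (f : α → List Bool) (l : List α)
    (hf : ∀ k ∈ l, f k ≠ [] → lo ≤ (f k).length ∧ ((f k).length : ℝ) ≤ hi) :
    (if ∃ k ∈ l, f k ≠ [] then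
      lo ≤ ((l.foldr (fun k m => xorPad (f k) m) []).length : ℝ) ∧
        ((l.foldr (fun k m => xorPad (f k) m) []).length : ℝ) ≤ hi
      else (l.foldr (fun k m => xorPad (f k) m) []).length = 0) := by
  induction l with
  | nil => simp
  | cons a l ih =>
    have ih := ih fun k hk => hf k (List.mem_cons_of_mem _ hk)
    have ha := hf a List.mem_cons_self
    simp only [List.foldr_cons, length_xorPad, Nat.cast_max]
    by_cases hl : ∃ k ∈ l, f k ≠ []
    · rw [if_pos hl] at ih
      rw [if_pos (by obtain ⟨k, hk, h⟩ := hl; exact ⟨k, List.mem_cons_of_mem _ hk, h⟩)]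
      refine ⟨ih.1.trans (le_max_right _ _), max_le ?_ ih.2⟩
      by_cases h : f a = []
      · rw [h]
        exact le_trans (by simp) ih.2
      · exact (ha h).2
    · rw [if_neg hl] at ih
      by_cases h : f a = []
      · rw [if_neg]
        · simp [h, ih]
        · rintro ⟨k, hk, h'⟩
          rcases List.mem_cons.1 hk with rfl | hk
          · exact h' h
          · exact hl ⟨k, hk, h'⟩
      · rw [if_pos ⟨a, List.mem_cons_self, h⟩, ih]
        simpa using ha h

namespace Delivery

variable {K N F : ℕ} (D : Delivery K N F)

/-- The number of bits transmitted for the encoding set `S` at the end of slot `b`. -/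
def sentBits (b : ℕ) (S : Finset (Fin K)) : ℕ :=
  if S ∈ D.sentSets b (D.delivered (b - 1)) then (D.message b (D.delivered (b - 1)) S).length else 0

theorem load_eq_sum_sentBits : D.load = ∑ S, ∑ b ∈ Finset.Icc 1 D.B, D.sentBits b S := by
  rw [load, Finset.sum_comm]
  refine Finset.sum_congr rfl fun b _ => ?_
  simp [sentBits, Finset.sum_ite_mem]

/-- For `k ∈ S` the pair `(k, S.erase k)` determines `S`, so messages for other encoding sets do not
affect it. This decouples the encoding sets. -/
theorem mem_delivered_succ {b : ℕ} {S : Finset (Fin K)} {k : Fin K} (hk : k ∈ S) :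
    (k, S.erase k) ∈ D.delivered (b + 1) ↔ (k, S.erase k) ∈ D.delivered b ∨
      S ∈ D.sentSets (b + 1) (D.delivered b) ∧ k ∈ active D.slot D.Δb (b + 1) := by
  rw [delivered, Finset.mem_union]
  refine or_congr_right ?_
  simp only [Finset.mem_biUnion, Finset.mem_image, Finset.mem_inter, Prod.mk.injEq]
  constructor
  · rintro ⟨S', hS', j, ⟨hj, hja⟩, rfl, h⟩
    have : S' = S := by rw [← Finset.insert_erase hj, h, Finset.insert_erase hk]
    exact this ▸ ⟨hS', hja⟩
  · rintro ⟨h1, h2⟩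
    exact ⟨S, h1, k, ⟨hk, h2⟩, rfl, rfl⟩

theorem mem_active {b : ℕ} (hpos : ∀ k, 1 ≤ D.slot k) {k : Fin K} :
    k ∈ active D.slot D.Δb b ↔ b < D.slot k + D.Δb ∧ D.slot k ≤ b := by
  rw [active, mem_biUnion_arrivals]
  have := hpos k
  omega

theorem length_message {b : ℕ} {done : Finset (Fin K × Finset (Fin K))} {S : Finset (Fin K)}
    {lo hi : ℝ} (hlen : ∀ k ∈ S, lo ≤ (D.subfile k (S.erase k)).length ∧
      ((D.subfile k (S.erase k)).length : ℝ) ≤ hi)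
    (hne : ∀ k ∈ S, D.subfile k (S.erase k) ≠ []) :
    if ∃ k ∈ S, k ∈ active D.slot D.Δb b ∧ (k, S.erase k) ∉ done then
      lo ≤ ((D.message b done S).length : ℝ) ∧ ((D.message b done S).length : ℝ) ≤ hi
    else (D.message b done S).length = 0 := by
  have key := length_foldr_xorPad (lo := lo) (hi := hi)
    (fun k => D.currentSubfile done k (S.erase k))
    ((S ∩ active D.slot D.Δb b).sort (· ≤ ·)) (by
      intro k hk h
      rw [Finset.mem_sort, Finset.mem_inter] at hk
      simp only [currentSubfile] at h ⊢
      split_ifs at h ⊢ with h'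
      · exact absurd rfl h
      · exact hlen k hk.1)
  have hiff : (∃ k ∈ (S ∩ active D.slot D.Δb b).sort (· ≤ ·),
      D.currentSubfile done k (S.erase k) ≠ []) ↔
      ∃ k ∈ S, k ∈ active D.slot D.Δb b ∧ (k, S.erase k) ∉ done := by
    refine exists_congr fun k => ?_
    rw [Finset.mem_sort, Finset.mem_inter, and_assoc]
    refine and_congr_right fun hk => and_congr_right fun _ => ?_
    rw [currentSubfile]
    split_ifs with h
    · simp [h]
    · simp [h, hne k hk]
  simp only [hiff] at key
  exact key

/-- The state of the delivery for the encoding set `S` at the end of a slot `b < B`: the subfiles of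
the requests which arrived up to some slot `c` have been delivered by `n` messages, and the partition
algorithm splits off the same requests in its first `n` passes. -/
theorem exists_state (hpos : ∀ k, 1 ≤ D.slot k) (hΔ : 1 ≤ D.Δb) (hΔB : D.Δb ≤ D.B)
    {S : Finset (Fin K)} {lo hi : ℝ} (hlen : ∀ k ∈ S, lo ≤ (D.subfile k (S.erase k)).length ∧
      ((D.subfile k (S.erase k)).length : ℝ) ≤ hi)
    (hne : ∀ k ∈ S, D.subfile k (S.erase k) ≠ []) (b : ℕ) (hb : b < D.B) :
    ∃ c n : ℕ, c ≤ b ∧ (∀ k ∈ S, (k, S.erase k) ∈ D.delivered b ↔ D.slot k ≤ c) ∧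
      (∀ k ∈ S, c < D.slot k → b + 1 < D.slot k + D.Δb) ∧
      eta D.slot D.Δb S = n + eta D.slot D.Δb (S.filter fun k => c < D.slot k) ∧
      n * lo ≤ (∑ i ∈ Finset.Icc 1 b, D.sentBits i S : ℕ) ∧
      ((∑ i ∈ Finset.Icc 1 b, D.sentBits i S : ℕ) : ℝ) ≤ n * hi := by
  induction b with
  | zero =>
    refine ⟨0, 0, le_rfl, fun k _ => ?_, fun k _ h => by omega, ?_, by simp, by simp⟩
    · have := hpos k
      simp only [delivered, Finset.notMem_empty, false_iff]
      omega
    · rw [Finset.filter_true_of_mem (p := fun k => 0 < D.slot k) fun k _ => hpos k, Nat.zero_add]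
  | succ b ih =>
    obtain ⟨c, n, hcb, hdel, hrest, heta, hlo, hhi⟩ := ih (by omega)
    -- The trigger is an undelivered request at its deadline. A delivered request arriving in slot
    -- `b + 2 - Δb` blocks the message, its subfile being empty. If that request is undelivered,
    -- then all active ones of `S` arrived no earlier, hence after `c`, and nothing blocks.
    have hsent : S ∈ D.sentSets (b + 1) (D.delivered b) ↔
        ∃ k ∈ S, D.slot k + D.Δb = b + 2 ∧ c < D.slot k := by
      rw [sentSets]
      by_cases h1 : D.Δb < D.B
      · rw [if_pos h1]
        by_cases h2 : b + 1 ≤ D.Δb - 1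
        · rw [if_pos h2]
          simp only [Finset.notMem_empty, false_iff, not_exists, not_and]
          intro k _ h
          have := hpos k
          omega
        · rw [if_neg h2, if_pos hb, Finset.mem_filter]
          simp only [Finset.mem_univ, true_and]
          constructor
          · rintro ⟨⟨k, hk⟩, h⟩
            simp only [Finset.mem_inter, arrivals, Finset.mem_filter, Finset.mem_univ,
              true_and] at hk
            refine ⟨k, hk.1, by omega, not_le.1 fun hkc => ?_⟩
            refine h k (Finset.mem_inter.2 ⟨hk.1, (D.mem_active hpos).2 ⟨by omega, by omega⟩⟩) ?_
            rw [currentSubfile, if_pos ((hdel k hk.1).2 hkc)]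
          · rintro ⟨k, hk, hks, hkc⟩
            refine ⟨⟨k, ?_⟩, fun j hj => ?_⟩
            · simp only [Finset.mem_inter, arrivals, Finset.mem_filter, Finset.mem_univ,
                true_and]
              exact ⟨hk, by omega⟩
            · rw [Finset.mem_inter, D.mem_active hpos] at hj
              rw [currentSubfile, if_neg]
              · exact hne j hj.1
              · rw [hdel j hj.1]
                omega
      · rw [if_neg h1, if_pos (by omega)]
        simp only [Finset.notMem_empty, false_iff, not_exists, not_and]
        intro k _ h
        have := hpos k
        omega
    rw [Finset.sum_Icc_succ_top (by omega), Nat.cast_add]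
    by_cases hS : S ∈ D.sentSets (b + 1) (D.delivered b)
    · obtain ⟨k, hk, hks, hkc⟩ := hsent.1 hS
      have hbits : D.sentBits (b + 1) S = (D.message (b + 1) (D.delivered b) S).length := by
        rw [sentBits, Nat.add_sub_cancel, if_pos hS]
      have hm := D.length_message (b := b + 1) (done := D.delivered b) hlen hne
      rw [if_pos ⟨k, hk, (D.mem_active hpos).2 ⟨by omega, by omega⟩,
        fun h => by have := (hdel k hk).1 h; omega⟩] at hm
      -- By `hrest` every undelivered request that has arrived is still active, so the message
      -- clears everything up to slot `b + 1`.
      refine ⟨b + 1, n + 1, le_rfl, fun j hj => ?_, fun j hj h => by omega, ?_, ?_, ?_⟩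
      · rw [D.mem_delivered_succ hj, hdel j hj, D.mem_active hpos]
        constructor
        · rintro (h | ⟨_, h⟩) <;> omega
        · intro h
          by_cases hjc : D.slot j ≤ c
          · exact Or.inl hjc
          · have := hrest j hj (by omega)
            exact Or.inr ⟨hS, by omega, h⟩
      -- By `hrest`, `k` is an earliest remaining request. Its pass covers the slots up to `D.slot k
      -- + Δb - 1 = b + 1`, just what the message serves.
      · have hstep := eta_step (S := S.filter fun k => c < D.slot k) (a := D.slot k) hΔ hpos
          (fun j hj => by
            rw [Finset.mem_filter] at hj
            have := hrest j hj.1 hj.2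
            omega) ⟨k, Finset.mem_filter.2 ⟨hk, hkc⟩, rfl⟩
        rw [heta, hstep, Finset.filter_filter, add_assoc, add_comm 1]
        congr 3
        refine Finset.filter_congr fun j _ => ?_
        omega
      · rw [hbits]
        push_cast at hlo ⊢
        linarith [hm.1]
      · rw [hbits]
        push_cast at hhi ⊢
        linarith [hm.2]
    · have hbits : D.sentBits (b + 1) S = 0 := by
        rw [sentBits, Nat.add_sub_cancel, if_neg hS]
      refine ⟨c, n, by omega, fun j hj => ?_, fun j hj h => ?_, heta, ?_, ?_⟩
      · rw [D.mem_delivered_succ hj, hdel j hj]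
        simp [hS]
      · have h1 := hrest j hj h
        have h2 : ¬ D.slot j + D.Δb = b + 2 := fun h' => hS (hsent.2 ⟨j, hj, h', h⟩)
        omega
      · simpa [hbits] using hlo
      · simpa [hbits] using hhi

/-- No deadline has been missed before slot `B`, so the remaining requests lie in the last `Δb`
slots and form a single pass. -/
theorem sum_sentBits_bounds (hpos : ∀ k, 1 ≤ D.slot k) (hB : ∀ k, D.slot k ≤ D.B)
    (hΔ : 1 ≤ D.Δb) (hΔB : D.Δb ≤ D.B)
    {S : Finset (Fin K)} {lo hi : ℝ} (hlen : ∀ k ∈ S, lo ≤ (D.subfile k (S.erase k)).length ∧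
      ((D.subfile k (S.erase k)).length : ℝ) ≤ hi)
    (hne : ∀ k ∈ S, D.subfile k (S.erase k) ≠ []) :
    eta D.slot D.Δb S * lo ≤ (∑ i ∈ Finset.Icc 1 D.B, D.sentBits i S : ℕ) ∧
      ((∑ i ∈ Finset.Icc 1 D.B, D.sentBits i S : ℕ) : ℝ) ≤ eta D.slot D.Δb S * hi := by
  obtain ⟨b, hb⟩ : ∃ b, D.B = b + 1 := Nat.exists_eq_add_one.2 (by omega)
  obtain ⟨c, n, hcb, hdel, hrest, heta, hlo, hhi⟩ :=
    D.exists_state hpos hΔ hΔB hlen hne b (by omega)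
  have hm := D.length_message (b := b + 1) (done := D.delivered b) hlen hne
  rw [hb, Finset.sum_Icc_succ_top (by omega), Nat.cast_add, heta]
  by_cases hR : (S.filter fun k => c < D.slot k).Nonempty
  · have hR' := hR
    obtain ⟨k, hk⟩ := hR'
    rw [Finset.mem_filter] at hk
    have hkr := hrest k hk.1 hk.2
    have hkB := hB k
    have hka : k ∈ active D.slot D.Δb (b + 1) :=
      (D.mem_active hpos).2 ⟨by omega, by omega⟩
    have hS : S ∈ D.sentSets (b + 1) (D.delivered b) := by
      rw [sentSets]
      by_cases h1 : D.Δb < D.B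
      · rw [if_pos h1, if_neg (by omega), if_neg (by omega), Finset.mem_filter]
        exact ⟨Finset.mem_univ _, k, Finset.mem_inter.2 ⟨hk.1, hka⟩⟩
      · rw [if_neg h1, if_neg (by omega), Finset.mem_filter]
        exact ⟨Finset.mem_univ _, k, hk.1⟩
    have hbits : D.sentBits (b + 1) S = (D.message (b + 1) (D.delivered b) S).length := by
      rw [sentBits, Nat.add_sub_cancel, if_pos hS]
    rw [if_pos ⟨k, hk.1, hka, fun h => by have := (hdel k hk.1).1 h; omega⟩] at hm
    rw [eta_eq_one (b := b + 1 - D.Δb) hΔ hpos hR fun j hj => by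
      rw [Finset.mem_filter] at hj
      have := hrest j hj.1 hj.2
      have := hB j
      omega]
    rw [hbits]
    push_cast at hlo hhi ⊢
    exact ⟨by linarith [hm.1], by linarith [hm.2]⟩
  -- `S` may be scheduled again at slot `B`, but the XOR of delivered subfiles has length zero.
  · have hbits : D.sentBits (b + 1) S = 0 := by
      rw [if_neg] at hm
      · rw [sentBits, Nat.add_sub_cancel, hm, ite_self]
      · rintro ⟨k, hk, _, h⟩
        exact hR ⟨k, Finset.mem_filter.2 ⟨hk, not_le.1 fun h' => h ((hdel k hk).2 h')⟩⟩
    rw [Finset.not_nonempty_iff_eq_empty.1 hR, eta_empty, hbits]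
    rw [Nat.add_zero, Nat.cast_zero, add_zero]
    exact ⟨hlo, hhi⟩

/-- The deterministic part of the load estimate; the random placement will enter only through `hlen`
and `hne`. -/
theorem abs_load_sub_le (hpos : ∀ k, 1 ≤ D.slot k) (hB : ∀ k, D.slot k ≤ D.B)
    (hΔ : 1 ≤ D.Δb) (hΔB : D.Δb ≤ D.B) {δ : ℝ} (p : ℕ → ℝ)
    (hlen : ∀ k T, k ∉ T → |((D.subfile k T).length : ℝ) - p T.card| ≤ δ)
    (hne : ∀ k T, k ∉ T → D.subfile k T ≠ []) :
    |(D.load : ℝ) - ∑ S, eta D.slot D.Δb S * p (S.card - 1)| ≤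
      ∑ S, eta D.slot D.Δb S * δ := by
  rw [load_eq_sum_sentBits, Nat.cast_sum, ← Finset.sum_sub_distrib]
  refine (Finset.abs_sum_le_sum_abs _ _).trans (Finset.sum_le_sum fun S _ => ?_)
  have h := D.sum_sentBits_bounds hpos hB hΔ hΔB (S := S) (lo := p (S.card - 1) - δ)
    (hi := p (S.card - 1) + δ) (fun k hk => by
      have := abs_le.1 (hlen k (S.erase k) (Finset.notMem_erase k S))
      rw [Finset.card_erase_of_mem hk] at this
      exact ⟨by linarith, by linarith⟩) (fun k _ => hne k _ (Finset.notMem_erase k S))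
  rw [abs_le]
  constructor <;> linarith [h.1, h.2]

theorem length_subfile (k : Fin K) (T : Finset (Fin K)) :
    (D.subfile k T).length = (Finset.univ.filter fun i : Fin F =>
      ∀ j : Fin K, i ∈ D.cache j (D.demand k) ↔ j ∈ T).card := by
  rw [subfile, List.length_map, Finset.length_sort]

end Delivery


/-! ### Counting encoding sets by a generating polynomial -/

open Polynomial

theorem sum_powerset_union {α M : Type*} [DecidableEq α] [AddCommMonoid M] {A B : Finset α}
    (h : Disjoint A B) (f : Finset α → M) :
    ∑ S ∈ (A ∪ B).powerset, f S = ∑ T ∈ A.powerset, ∑ R ∈ B.powerset, f (T ∪ R) := by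
  rw [← Finset.sum_product']
  symm
  refine Finset.sum_nbij' (fun x => x.1 ∪ x.2) (fun S => (S ∩ A, S ∩ B)) ?_ ?_ ?_ ?_ ?_
  · intro x hx
    simp only [Finset.mem_product, Finset.mem_powerset] at hx ⊢
    exact Finset.union_subset_union hx.1 hx.2
  · intro S _
    simp [Finset.inter_subset_right]
  · rintro ⟨T, R⟩ hx
    simp only [Finset.mem_product, Finset.mem_powerset] at hx
    rw [Finset.disjoint_left] at h
    ext k <;> simp only [Finset.mem_inter, Finset.mem_union] <;> constructor
    · rintro ⟨h1 | h1, h2⟩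
      · exact h1
      · exact absurd (hx.2 h1) (h h2)
    · exact fun h1 => ⟨Or.inl h1, hx.1 h1⟩
    · rintro ⟨h1 | h1, h2⟩
      · exact absurd h2 (h (hx.1 h1))
      · exact h1
    · exact fun h1 => ⟨Or.inr h1, hx.2 h1⟩
  · intro S hS
    rw [Finset.mem_powerset] at hS
    rw [← Finset.inter_union_distrib_left, Finset.inter_eq_left.2 hS]
  · intro x _
    rfl

theorem sum_powerset_X_pow {α : Type*} [DecidableEq α] (A : Finset α) :
    ∑ T ∈ A.powerset, (X : ℤ[X]) ^ T.card = (1 + X) ^ A.card := by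
  have := Finset.sum_pow_mul_eq_add_pow (X : ℤ[X]) 1 A
  simpa [add_comm] using this

section Generating

variable {K : ℕ} {slot : Fin K → ℕ} {Δb : ℕ}

/-- The F-APs whose requests arrive in the slots `a + 1, …, a + n`. -/
def window (slot : Fin K → ℕ) (a n : ℕ) : Finset (Fin K) :=
  Finset.univ.filter fun k => a < slot k ∧ slot k ≤ a + n

/-- The F-APs whose requests arrive after slot `a`. -/
def lateArrivals (slot : Fin K → ℕ) (a : ℕ) : Finset (Fin K) :=
  Finset.univ.filter fun k => a < slot k

/-- The generating polynomial, by size, of the sets of F-APs with requests after slot `a` which the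
partition algorithm splits into `Y` subsets. -/
noncomputable def etaPoly (slot : Fin K → ℕ) (Δb a Y : ℕ) : ℤ[X] :=
  ∑ S ∈ (lateArrivals slot a).powerset, if eta slot Δb S = Y then X ^ S.card else 0

theorem lateArrivals_eq_union (a n : ℕ) :
    lateArrivals slot a = window slot a n ∪ lateArrivals slot (a + n) := by
  ext k
  simp only [lateArrivals, window, Finset.mem_union, Finset.mem_filter, Finset.mem_univ, true_and]
  omega

theorem disjoint_window_late (a n : ℕ) :
    Disjoint (window slot a n) (lateArrivals slot (a + n)) := by
  rw [Finset.disjoint_left]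
  intro k
  simp only [lateArrivals, window, Finset.mem_filter, Finset.mem_univ, true_and]
  omega

theorem etaPoly_of_le {B a Y : ℕ} (hB : ∀ k, slot k ≤ B) (ha : B ≤ a) :
    etaPoly slot Δb a Y = if Y = 0 then 1 else 0 := by
  have : lateArrivals slot a = ∅ := by
    rw [lateArrivals, Finset.filter_eq_empty_iff]
    intro k _
    have := hB k
    omega
  simp [etaPoly, this, eq_comm]

theorem etaPoly_zero (hΔ : 1 ≤ Δb) (hpos : ∀ k, 1 ≤ slot k) (a : ℕ) :
    etaPoly slot Δb a 0 = 1 := by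
  rw [etaPoly, Finset.sum_eq_single ∅]
  · simp
  · intro S _ hS
    have := eta_pos hΔ hpos (Finset.nonempty_iff_ne_empty.2 hS)
    rw [if_neg (by omega)]
  · intro h
    simp at h

/-- If `S` misses slot `a + 1`, that slot can be dropped. Otherwise the first pass takes a nonempty
part `T` of that slot and any part `Q` of the next `Δb - 1` slots, and the rest `R` must need `Y`
passes. -/
theorem etaPoly_succ (hΔ : 1 ≤ Δb) (hpos : ∀ k, 1 ≤ slot k) (a Y : ℕ) :
    etaPoly slot Δb a (Y + 1) = etaPoly slot Δb (a + 1) (Y + 1) +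
      ((1 + X) ^ (window slot a 1).card - 1) * (1 + X) ^ (window slot (a + 1) (Δb - 1)).card *
        etaPoly slot Δb (a + Δb) Y := by
  have hΔ' : a + 1 + (Δb - 1) = a + Δb := by omega
  conv_lhs => rw [etaPoly, lateArrivals_eq_union a 1,
    sum_powerset_union (disjoint_window_late a 1),
    ← Finset.add_sum_erase _ _ (Finset.empty_mem_powerset _)]
  congr 1
  · simp [etaPoly]
  · have h1 : ((1 + X) ^ (window slot a 1).card - 1 : ℤ[X]) =
        ∑ T ∈ (window slot a 1).powerset.erase ∅, X ^ T.card := by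
      rw [← sum_powerset_X_pow, ← Finset.add_sum_erase _ _ (Finset.empty_mem_powerset _)]
      simp
    rw [h1, ← sum_powerset_X_pow, Finset.sum_mul_sum, Finset.sum_mul]
    refine Finset.sum_congr rfl fun T hT => ?_
    rw [Finset.mem_erase, Finset.mem_powerset] at hT
    obtain ⟨k₀, hk₀⟩ := Finset.nonempty_iff_ne_empty.2 hT.1
    rw [lateArrivals_eq_union (a + 1) (Δb - 1), sum_powerset_union (disjoint_window_late _ _),
      Finset.sum_mul, hΔ']
    refine Finset.sum_congr rfl fun Q hQ => ?_
    rw [Finset.mem_powerset] at hQ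
    rw [etaPoly, Finset.mul_sum]
    refine Finset.sum_congr rfl fun R hR => ?_
    rw [Finset.mem_powerset] at hR
    have hTs : ∀ k ∈ T, slot k = a + 1 := fun k hk => by
      have := hT.2 hk
      simp only [window, Finset.mem_filter, Finset.mem_univ, true_and] at this
      omega
    have hQs : ∀ k ∈ Q, a + 1 < slot k ∧ slot k ≤ a + Δb := fun k hk => by
      have := hQ hk
      simp only [window, Finset.mem_filter, Finset.mem_univ, true_and] at this
      omega
    have hRs : ∀ k ∈ R, a + Δb < slot k := fun k hk => by
      have := hR hk
      simpa only [lateArrivals, Finset.mem_filter, Finset.mem_univ, true_and] using this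
    have heta : eta slot Δb (T ∪ (Q ∪ R)) = eta slot Δb R + 1 := by
      rw [eta_step (a := a + 1) hΔ hpos]
      · congr 2
        ext k
        simp only [Finset.mem_filter, Finset.mem_union]
        constructor
        · rintro ⟨h | h | h, h'⟩
          · have := hTs k h
            omega
          · have := hQs k h
            omega
          · exact h
        · intro h
          have := hRs k h
          exact ⟨Or.inr (Or.inr h), by omega⟩
      · intro k hk
        simp only [Finset.mem_union] at hk
        rcases hk with h | h | h
        · exact (hTs k h).ge
        · exact (hQs k h).1.le
        · have := hRs k h
          omega
      · exact ⟨k₀, Finset.mem_union_left _ hk₀, hTs k₀ hk₀⟩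
    have hcard : (T ∪ (Q ∪ R)).card = T.card + Q.card + R.card := by
      rw [Finset.card_union_of_disjoint, Finset.card_union_of_disjoint, add_assoc]
      · rw [Finset.disjoint_left]
        intro k h h'
        have := hQs k h
        have := hRs k h'
        omega
      · rw [Finset.disjoint_left]
        intro k h h'
        have := hTs k h
        rcases Finset.mem_union.1 h' with h' | h'
        · have := hQs k h'
          omega
        · have := hRs k h'
          omega
    rw [heta, hcard]
    simp only [Nat.add_right_cancel_iff, mul_ite, mul_zero, pow_add]

end Generating

/-- The number of ways to place `Y` windows of `D + 1` slots, followed by one of `d` slots which ends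
in the last slot, among `r` slots. -/
def truncatedPlacements (D r Y d : ℕ) : ℕ :=
  if d + Y * (D + 1) ≤ r then (r - d - Y * D).choose Y else 0

/-- Pascal's rule: the first slot is unused or starts a window. The condition `D ≤ r` matters only
for `Y = 0`, where `Nat.choose _ 0` is one even if the window does not fit. -/
theorem choose_windows_succ (D r Y : ℕ) :
    (r + 1 - (Y + 1) * D).choose (Y + 1) =
      (r - (Y + 1) * D).choose (Y + 1) + if D ≤ r then (r - D - Y * D).choose Y else 0 := by
  have hm : (Y + 1) * D = Y * D + D := Nat.succ_mul _ _
  rw [hm]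
  by_cases h : Y * D + D ≤ r
  · rw [if_pos (by omega), show r + 1 - (Y * D + D) = r - D - Y * D + 1 by omega,
      show r - (Y * D + D) = r - D - Y * D by omega, Nat.choose_succ_succ, add_comm]
  · rw [show r + 1 - (Y * D + D) = 0 by omega, show r - (Y * D + D) = 0 by omega]
    split_ifs with h1
    · rw [show r - D - Y * D = 0 by omega]
      cases Y with
      | zero => omega
      | succ Y => simp
    · simp

/-- A lone truncated window ends in the last slot, so its position is forced; one more slot only
admits the length `r + 1`. -/
theorem truncatedPlacements_zero_succ (D r d : ℕ) :
    truncatedPlacements D (r + 1) 0 d = truncatedPlacements D r 0 d + if d = r + 1 then 1 else 0 := by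
  simp only [truncatedPlacements, Nat.zero_mul, add_zero, Nat.choose_zero_right]
  split_ifs <;> omega

theorem truncatedPlacements_succ_succ (D r Y d : ℕ) (hd : 1 ≤ d) :
    truncatedPlacements D (r + 1) (Y + 1) d =
      truncatedPlacements D r (Y + 1) d + truncatedPlacements D (r - D) Y d := by
  have hm : (Y + 1) * D = Y * D + D := Nat.succ_mul _ _
  have hm1 : (Y + 1) * (D + 1) = Y * (D + 1) + D + 1 := by ring
  have hm2 : Y * (D + 1) = Y * D + Y := by ring
  simp only [truncatedPlacements, hm, hm1]
  by_cases h : d + (Y * (D + 1) + D + 1) ≤ r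
  · rw [if_pos h, if_pos (by omega), if_pos (by omega),
      show r + 1 - d - (Y * D + D) = r - D - d - Y * D + 1 by omega,
      show r - d - (Y * D + D) = r - D - d - Y * D by omega, Nat.choose_succ_succ, add_comm]
  · rw [if_neg h]
    by_cases h' : d + (Y * (D + 1) + D + 1) = r + 1
    · rw [if_pos (by omega), if_pos (by omega),
        show r + 1 - d - (Y * D + D) = Y + 1 by omega,
        show r - D - d - Y * D = Y by omega]
      simp
    · rw [if_neg (by omega), if_neg (by omega)]

/-- Closed form of `etaPoly`, with `r` slots left and `D = Δb - 1`. -/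
noncomputable def etaClosed (L D r : ℕ) : ℕ → ℤ[X]
  | 0 => 1
  | Y + 1 => ((1 + X) ^ L - 1) ^ (Y + 1) *
      (((r - (Y + 1) * D).choose (Y + 1) : ℤ[X]) * (1 + X) ^ ((Y + 1) * D * L) +
        ∑ d ∈ Finset.Icc 1 D,
          (truncatedPlacements D r Y d : ℤ[X]) * (1 + X) ^ ((Y * D + d - 1) * L))

theorem etaClosed_zero (L D Y : ℕ) : etaClosed L D 0 Y = if Y = 0 then 1 else 0 := by
  cases Y with
  | zero => simp [etaClosed]
  | succ Y =>
    rw [etaClosed, if_neg (Nat.succ_ne_zero _), Nat.zero_sub, Nat.choose_zero_succ,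
      Finset.sum_eq_zero]
    · simp
    · intro d hd
      rw [truncatedPlacements, if_neg]
      · simp
      · have := (Finset.mem_Icc.1 hd).1
        omega

/-- The same recursion as `etaPoly_succ`. A first window starting in the first slot is complete if
`D ≤ r`; otherwise it swallows all the remaining slots and must be the only one. -/
theorem etaClosed_succ (L D r Y : ℕ) :
    etaClosed L D (r + 1) (Y + 1) = etaClosed L D r (Y + 1) +
      ((1 + X) ^ L - 1) * (1 + X) ^ (min D r * L) * etaClosed L D (r - D) Y := by
  cases Y with
  | zero =>
    simp only [etaClosed]
    rw [choose_windows_succ]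
    simp only [truncatedPlacements_zero_succ, Nat.cast_add, add_mul, Finset.sum_add_distrib]
    simp only [Nat.cast_ite, Nat.cast_zero, Nat.cast_one, ite_mul, one_mul, zero_mul,
      Finset.sum_ite_eq', Finset.mem_Icc]
    by_cases h : D ≤ r
    · rw [if_neg (by omega : ¬ (1 ≤ r + 1 ∧ r + 1 ≤ D)), if_pos h, min_eq_left h]
      simp
      ring
    · rw [if_pos (by omega : 1 ≤ r + 1 ∧ r + 1 ≤ D), if_neg h, min_eq_right (by omega)]
      simp
      ring
  | succ Y =>
    have hsum : ∑ d ∈ Finset.Icc 1 D, (truncatedPlacements D (r + 1) (Y + 1) d : ℤ[X]) *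
          (1 + X) ^ (((Y + 1) * D + d - 1) * L) =
        ∑ d ∈ Finset.Icc 1 D, (truncatedPlacements D r (Y + 1) d : ℤ[X]) *
          (1 + X) ^ (((Y + 1) * D + d - 1) * L) +
        (1 + X) ^ (D * L) * ∑ d ∈ Finset.Icc 1 D, (truncatedPlacements D (r - D) Y d : ℤ[X]) *
          (1 + X) ^ ((Y * D + d - 1) * L) := by
      rw [Finset.mul_sum, ← Finset.sum_add_distrib]
      refine Finset.sum_congr rfl fun d hd => ?_
      have hd := (Finset.mem_Icc.1 hd).1
      rw [truncatedPlacements_succ_succ D r Y d hd,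
        show ((Y + 1) * D + d - 1) = D + (Y * D + d - 1) by rw [Nat.succ_mul]; omega]
      push_cast
      ring
    by_cases h : D ≤ r
    · simp only [etaClosed, hsum, choose_windows_succ D r (Y + 1), if_pos h, min_eq_left h]
      push_cast
      ring
    · have h0 : r - D = 0 := by omega
      have h1 : etaClosed L D 0 (Y + 1) = 0 := by simp [etaClosed_zero]
      have h2 : ∀ d ∈ Finset.Icc 1 D, (truncatedPlacements D 0 Y d : ℤ[X]) *
          (1 + X) ^ ((Y * D + d - 1) * L) = 0 := fun d hd => by
        have := (Finset.mem_Icc.1 hd).1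
        rw [truncatedPlacements, if_neg (by omega)]
        simp
      rw [h0, Finset.sum_eq_zero h2] at hsum
      rw [h0, h1, etaClosed, etaClosed, hsum, choose_windows_succ D r (Y + 1), if_neg h]
      simp

theorem etaPoly_eq_etaClosed {K L B Δb : ℕ} {slot : Fin K → ℕ} (hΔ : 1 ≤ Δb)
    (hslot : ∀ k, slot k ∈ Finset.Icc 1 B)
    (harr : ∀ b ∈ Finset.Icc 1 B, (arrivals slot b).card = L) (a Y : ℕ) :
    etaPoly slot Δb a Y = etaClosed L (Δb - 1) (B - a) Y := by
  have hpos : ∀ k, 1 ≤ slot k := fun k => (Finset.mem_Icc.1 (hslot k)).1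
  have hB : ∀ k, slot k ≤ B := fun k => (Finset.mem_Icc.1 (hslot k)).2
  obtain ⟨r, hr⟩ : ∃ r, B - a = r := ⟨_, rfl⟩
  induction r using Nat.strong_induction_on generalizing a Y with
  | _ r ih =>
    rcases r.eq_zero_or_pos with rfl | hr0
    · rw [hr, etaClosed_zero, etaPoly_of_le hB (by omega)]
    cases Y with
    | zero => rw [etaPoly_zero hΔ hpos, etaClosed]
    | succ Y =>
      obtain ⟨r, rfl⟩ := Nat.exists_eq_add_one.2 hr0
      have hw1 : (window slot a 1).card = L := by
        rw [window, card_window harr a 1 (by omega), one_mul]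
      -- Only `r` slots follow slot `a + 1`, so the window may overhang the end.
      have hw2 : (window slot (a + 1) (Δb - 1)).card = min (Δb - 1) r * L := by
        have : window slot (a + 1) (Δb - 1) = window slot (a + 1) (min (Δb - 1) r) := by
          ext k
          have := hB k
          simp only [window, Finset.mem_filter, Finset.mem_univ, true_and]
          omega
        rw [this, window, card_window harr _ _ (by omega)]
      rw [etaPoly_succ hΔ hpos, ih r (by omega) (a + 1) _ (by omega),
        ih (r - (Δb - 1)) (by omega) (a + Δb) _ (by omega), hw1, hw2, hr, etaClosed_succ,
        show B - (a + 1) = r by omega, show B - (a + Δb) = r - (Δb - 1) by omega]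

theorem coeff_etaPoly {K Δb : ℕ} {slot : Fin K → ℕ} (hpos : ∀ k, 1 ≤ slot k) (s Y : ℕ) :
    (etaPoly slot Δb 0 Y).coeff s = (Finset.univ.filter fun S : Finset (Fin K) =>
        S.card = s ∧ eta slot Δb S = Y).card := by
  have : lateArrivals slot 0 = Finset.univ :=
    Finset.filter_true_of_mem fun k _ => hpos k
  rw [etaPoly, this, Finset.powerset_univ, finsetSum_coeff, Finset.card_filter, Nat.cast_sum]
  refine Finset.sum_congr rfl fun S _ => ?_
  rw [apply_ite (fun f : ℤ[X] => f.coeff s), coeff_X_pow, coeff_zero]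
  split_ifs <;> simp_all


/-! ### Coefficients of the closed form and the numbers `q` -/

theorem coeff_one_add_X_pow_sub_one (L v : ℕ) :
    ((1 + X : ℤ[X]) ^ L - 1).coeff v = if 1 ≤ v then (L.choose v : ℤ) else 0 := by
  rw [coeff_sub, coeff_one_add_X_pow, coeff_one]
  rcases v.eq_zero_or_pos with rfl | h
  · simp
  · rw [if_neg (by omega), if_pos (by omega), sub_zero]

/-- Factoring out `X` gives the lowest coefficients of the powers of `(1 + X)^L - 1`. -/
theorem exists_X_mul_eq (L : ℕ) :
    ∃ u : ℤ[X], (1 + X : ℤ[X]) ^ L - 1 = X * u ∧ u.coeff 0 = L := by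
  obtain ⟨u, hu⟩ := X_dvd_iff.2 (show ((1 + X : ℤ[X]) ^ L - 1).coeff 0 = 0 by
    rw [coeff_one_add_X_pow_sub_one, if_neg (by omega)])
  refine ⟨u, hu, ?_⟩
  have := coeff_one_add_X_pow_sub_one L 1
  rw [hu, coeff_X_mul] at this
  simpa using this

theorem coeff_pow_of_lt (L : ℕ) {Y α : ℕ} (h : α < Y) :
    (((1 + X : ℤ[X]) ^ L - 1) ^ Y).coeff α = 0 := by
  obtain ⟨u, hu, _⟩ := exists_X_mul_eq L
  rw [hu, mul_pow, coeff_X_pow_mul', if_neg (by omega)]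

theorem coeff_pow_self (L Y : ℕ) : (((1 + X : ℤ[X]) ^ L - 1) ^ Y).coeff Y = (L : ℤ) ^ Y := by
  obtain ⟨u, hu, h0⟩ := exists_X_mul_eq L
  rw [hu, mul_pow, coeff_X_pow_mul', if_pos le_rfl, Nat.sub_self, coeff_zero_eq_eval_zero,
    eval_pow, ← coeff_zero_eq_eval_zero, h0]

theorem natDegree_one_add_X_pow_sub_one_le (L : ℕ) : ((1 + X : ℤ[X]) ^ L - 1).natDegree ≤ L := by
  rw [natDegree_le_iff_coeff_eq_zero]
  intro v hv
  rw [coeff_one_add_X_pow_sub_one, Nat.choose_eq_zero_of_lt hv]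
  simp

theorem coeff_pow_of_gt (L : ℕ) {Y α : ℕ} (h : Y * L < α) :
    (((1 + X : ℤ[X]) ^ L - 1) ^ Y).coeff α = 0 :=
  coeff_eq_zero_of_natDegree_lt
    ((natDegree_pow_le_of_le Y (natDegree_one_add_X_pow_sub_one_le L)).trans_lt h)

/-- `bCount L Y α` counts the sets of `α` F-APs which meet each of `Y` slots. -/
theorem coeff_pow_eq_bCount {L : ℕ} (hL : 1 ≤ L) (Y α : ℕ) :
    (((1 + X : ℤ[X]) ^ L - 1) ^ (Y + 1)).coeff α = bCount L (Y + 1) α := by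
  induction Y generalizing α with
  | zero =>
    rw [zero_add, pow_one, coeff_one_add_X_pow_sub_one, bCount]
    by_cases h1 : 1 ≤ α
    · by_cases h2 : α ≤ L
      · rw [if_pos h1, if_pos ⟨h1, h2⟩]
      · rw [if_pos h1, if_neg (by omega), Nat.choose_eq_zero_of_lt (by omega)]
    · rw [if_neg h1, if_neg (by omega), Nat.cast_zero]
  | succ Y ih =>
    rw [bCount]
    by_cases h1 : α = Y + 2
    · rw [if_pos h1, h1, show Y + 1 + 1 = Y + 2 from rfl, coeff_pow_self, Nat.choose_one_right]
      push_cast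
      rfl
    rw [if_neg h1]
    -- The special value in `bCount` is the top coefficient: every request of every slot is chosen.
    by_cases h2 : 1 < L ∧ α = (Y + 2) * L
    · rw [if_pos h2, h2.2, show Y + 1 + 1 = Y + 2 from rfl,
        coeff_pow_of_natDegree_le (natDegree_one_add_X_pow_sub_one_le L),
        coeff_one_add_X_pow_sub_one, if_pos hL, Nat.choose_self]
      simp
    rw [if_neg h2, pow_succ', coeff_mul,
      Finset.Nat.sum_antidiagonal_eq_sum_range_succ (fun i j =>
        ((1 + X : ℤ[X]) ^ L - 1).coeff i * (((1 + X : ℤ[X]) ^ L - 1) ^ (Y + 1)).coeff j),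
      Nat.cast_sum]
    symm
    -- The omitted terms vanish: `v = 0`, `v > L`, or fewer than `Y + 1` requests left for `Y + 1`
    -- slots.
    refine Finset.sum_subset_zero_on_sdiff ?_ ?_ ?_
    · intro v hv
      rw [Finset.mem_Icc, le_min_iff] at hv
      rw [Finset.mem_range]
      omega
    · intro v hv
      rw [Finset.mem_sdiff, Finset.mem_range, Finset.mem_Icc, le_min_iff] at hv
      by_cases h3 : 1 ≤ v
      · by_cases h4 : v ≤ L
        · rw [coeff_pow_of_lt L (by omega), mul_zero]
        · rw [coeff_one_add_X_pow_sub_one, Nat.choose_eq_zero_of_lt (by omega)]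
          simp
      · rw [coeff_one_add_X_pow_sub_one, if_neg h3, zero_mul]
    · intro v hv
      rw [Finset.mem_Icc] at hv
      rw [coeff_one_add_X_pow_sub_one, if_pos hv.1, ih]
      push_cast
      rfl

/-- The number of sets of `s` F-APs among those of `Y + n` slots which meet each of the first `Y`
slots. -/
def meetingCount (L s Y n : ℕ) : ℕ :=
  ∑ α ∈ Finset.Icc (max Y (s - n * L)) (min s (Y * L)),
    bCount L Y α * (n * L).choose (s - α)

theorem coeff_eq_meetingCount {L : ℕ} (hL : 1 ≤ L) (s Y n : ℕ) :
    (((1 + X : ℤ[X]) ^ L - 1) ^ (Y + 1) * (1 + X : ℤ[X]) ^ (n * L)).coeff s =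
      (meetingCount L s (Y + 1) n : ℤ) := by
  rw [coeff_mul, Finset.Nat.sum_antidiagonal_eq_sum_range_succ (fun i j =>
        (((1 + X : ℤ[X]) ^ L - 1) ^ (Y + 1)).coeff i * ((1 + X : ℤ[X]) ^ (n * L)).coeff j),
      meetingCount, Nat.cast_sum]
  symm
  refine Finset.sum_subset_zero_on_sdiff ?_ ?_ ?_
  · intro v hv
    rw [Finset.mem_Icc, le_min_iff] at hv
    rw [Finset.mem_range]
    omega
  · intro v hv
    rw [Finset.mem_sdiff, Finset.mem_range, Finset.mem_Icc, le_min_iff, max_le_iff] at hv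
    by_cases h1 : v < Y + 1
    · rw [coeff_pow_of_lt L h1, zero_mul]
    by_cases h2 : (Y + 1) * L < v
    · rw [coeff_pow_of_gt L h2, zero_mul]
    · rw [coeff_one_add_X_pow, Nat.choose_eq_zero_of_lt (by omega)]
      simp
  · intro v _
    rw [coeff_pow_eq_bCount hL, coeff_one_add_X_pow]
    push_cast
    rfl

/-- The available slots hold fewer than `s` requests, and the summation interval is empty. -/
theorem meetingCount_eq_zero {L s Y n : ℕ} (h : (Y + n) * L < s) : meetingCount L s Y n = 0 := by
  rw [Nat.add_mul] at h
  rw [meetingCount, Finset.Icc_eq_empty, Finset.sum_empty]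
  rw [le_min_iff, max_le_iff, max_le_iff]
  omega

theorem coeff_etaClosed {L : ℕ} (hL : 1 ≤ L) (D r Y s : ℕ) :
    (etaClosed L D r (Y + 1)).coeff s =
      ((r - (Y + 1) * D).choose (Y + 1) * meetingCount L s (Y + 1) ((Y + 1) * D) +
        ∑ d ∈ Finset.Icc 1 D,
          truncatedPlacements D r Y d * meetingCount L s (Y + 1) (Y * D + d - 1) : ℕ) := by
  rw [etaClosed, mul_add, Finset.mul_sum, coeff_add, finsetSum_coeff, mul_left_comm,
    ← C_eq_natCast, coeff_C_mul, coeff_eq_meetingCount hL]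
  push_cast
  congr 1
  refine Finset.sum_congr rfl fun d _ => ?_
  rw [mul_left_comm, ← C_eq_natCast, coeff_C_mul, coeff_eq_meetingCount hL]

theorem q₂_eq {L : ℕ} (hL : 1 ≤ L) (B s Y Δb : ℕ) :
    q₂ B L s (Y + 1) Δb =
      (B - (Y + 1) * (Δb - 1)).choose (Y + 1) * meetingCount L s (Y + 1) ((Y + 1) * (Δb - 1)) := by
  rw [q₂]
  split_ifs with h
  -- With `Δb = 1` the windows have no free slots; two expressions for the same coefficient show
  -- that the sum collapses.
  · have h1 := coeff_eq_meetingCount hL s Y 0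
    rw [zero_mul, pow_zero, mul_one, coeff_pow_eq_bCount hL] at h1
    rw [h, Nat.sub_self, Nat.mul_zero, Nat.sub_zero]
    congr 1
    exact_mod_cast h1
  · rfl

theorem q₁_eq {B L s Y d Δb : ℕ} (hΔ : 1 ≤ Δb) (h : d + Y * Δb ≤ B) :
    q₁ B L s (Y + 1) d Δb =
      truncatedPlacements (Δb - 1) B Y d * meetingCount L s (Y + 1) (Y * (Δb - 1) + d - 1) := by
  obtain ⟨D, rfl⟩ := Nat.exists_eq_add_one.2 hΔ
  have : Y * (D + 1) + d - (Y + 1) = Y * D + d - 1 := by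
    rw [Nat.mul_add]
    omega
  rw [q₁, truncatedPlacements, Nat.add_sub_cancel, Nat.add_sub_cancel, if_pos h, meetingCount, this]

/-- Turns the rational ceiling into a capacity condition on `Y` complete windows and a last one of
`d` slots. -/
theorem lt_minLast_iff {L s Y Δb d : ℕ} (hL : 1 ≤ L) (hd : 1 ≤ d) :
    d < minLast L s (Y + 1) Δb ↔ (Y * Δb + d) * L < s := by
  have hL' : (0 : ℚ) < L := by exact_mod_cast hL
  rw [minLast, lt_max_iff, Nat.lt_ceil, lt_div_iff₀ hL', or_iff_left (by omega)]
  have : (d * L : ℚ) < s - ((Y + 1 : ℕ) - 1) * Δb * L ↔ (((Y * Δb + d) * L : ℕ) : ℚ) < s := by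
    push_cast
    constructor <;> intro h <;> linarith
  rw [this, Nat.cast_lt]

theorem meetingCount_eq_zero_of_lt {L s Y Δb d : ℕ} (hL : 1 ≤ L) (hΔ : 1 ≤ Δb) (hd : 1 ≤ d)
    (h : d < minLast L s (Y + 1) Δb) : meetingCount L s (Y + 1) (Y * (Δb - 1) + d - 1) = 0 := by
  rw [lt_minLast_iff hL hd] at h
  refine meetingCount_eq_zero (lt_of_eq_of_lt ?_ h)
  obtain ⟨D, rfl⟩ := Nat.exists_eq_add_one.2 hΔ
  rw [Nat.add_sub_cancel, Nat.mul_add Y]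
  congr 1
  omega

/-- The coefficients of the generating polynomial are the numbers `q(s, Y, Δb)`. -/
theorem q_eq_of_lt {K B L Δb s Y : ℕ} (hL : 1 ≤ L) (hΔ : 1 ≤ Δb) (hΔB : Δb < B)
    (hs : s ≤ (Y + 1) * (Δb * L)) (hY : Y * Δb < B) :
    q K B L s (Y + 1) Δb =
      (B - (Y + 1) * (Δb - 1)).choose (Y + 1) * meetingCount L s (Y + 1) ((Y + 1) * (Δb - 1)) +
        ∑ d ∈ Finset.Icc 1 (Δb - 1),
          truncatedPlacements (Δb - 1) B Y d * meetingCount L s (Y + 1) (Y * (Δb - 1) + d - 1) := by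
  have hm1 : 1 ≤ minLast L s (Y + 1) Δb := le_max_right _ _
  have hmΔ : minLast L s (Y + 1) Δb ≤ Δb := by
    rw [← not_lt, lt_minLast_iff hL hΔ, not_lt]
    calc s ≤ _ := hs
      _ = _ := by ring
  have hzero : ∀ d, 1 ≤ d → d < minLast L s (Y + 1) Δb →
      truncatedPlacements (Δb - 1) B Y d * meetingCount L s (Y + 1) (Y * (Δb - 1) + d - 1) = 0 :=
    fun d hd h => by rw [meetingCount_eq_zero_of_lt hL hΔ hd h, mul_zero]
  have hD : Δb - 1 + 1 = Δb := by omega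
  rw [q, if_neg hΔB.ne, ← q₂_eq hL]
  split_ifs with h1 h2 h3 h4
  · rw [h1]
    simp
  -- Here every truncated last window is too short to accommodate `s` requests.
  · rw [Finset.sum_eq_zero, add_zero]
    intro d hd
    rw [Finset.mem_Icc] at hd
    exact hzero d hd.1 (by omega)
  · rw [Nat.add_sub_cancel] at h3
    rw [add_comm]
    congr 1
    rw [Finset.sum_congr rfl fun d hd => q₁_eq (d := d) hΔ (by rw [Finset.mem_Icc] at hd; omega)]
    refine Finset.sum_subset_zero_on_sdiff ?_ ?_ fun _ _ => rfl
    · intro d hd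
      rw [Finset.mem_Icc] at hd ⊢
      omega
    · intro d hd
      rw [Finset.mem_sdiff, Finset.mem_Icc, Finset.mem_Icc] at hd
      exact hzero d hd.1.1 (by omega)
  -- Now `Y + 1` complete windows do not fit into `B` slots, so the `q₂` term is zero, and truncated
  -- windows longer than `B - Y * Δb` do not fit either.
  · rw [Nat.add_sub_cancel] at h4 ⊢
    have hYD : (Y + 1) * (Δb - 1) + (Y + 1) = Y * Δb + Δb := by
      rw [← Nat.mul_succ, Nat.succ_eq_add_one, hD, Nat.succ_mul]
    rw [q₂_eq hL, Nat.choose_eq_zero_of_lt (by omega), zero_mul, zero_add]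
    rw [Finset.sum_congr rfl fun d hd => q₁_eq (d := d) hΔ (by rw [Finset.mem_Icc] at hd; omega)]
    refine Finset.sum_subset_zero_on_sdiff ?_ ?_ fun _ _ => rfl
    · intro d hd
      rw [Finset.mem_Icc] at hd ⊢
      omega
    · intro d hd
      rw [Finset.mem_sdiff, Finset.mem_Icc, Finset.mem_Icc] at hd
      by_cases h5 : d < minLast L s (Y + 1) Δb
      · exact hzero d hd.1.1 h5
      · rw [truncatedPlacements, hD, if_neg (by omega), zero_mul]
  · rw [Nat.add_sub_cancel] at h3 h4
    omega

theorem card_filter_eta_eq {K B L Δb : ℕ} {slot : Fin K → ℕ} (hL : 1 ≤ L) (hΔ : 1 ≤ Δb)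
    (hΔB : Δb ≤ B) (hslot : ∀ k, slot k ∈ Finset.Icc 1 B)
    (harr : ∀ b ∈ Finset.Icc 1 B, (arrivals slot b).card = L) {s Y : ℕ} (hs : 1 ≤ s)
    (hY : Y ∈ rangeY B L s Δb) :
    (Finset.univ.filter fun S : Finset (Fin K) =>
        S.card = s ∧ eta slot Δb S = Y).card = q K B L s Y Δb := by
  have hpos : ∀ k, 1 ≤ slot k := fun k => (Finset.mem_Icc.1 (hslot k)).1
  have hΔ' : (0 : ℚ) < Δb := by exact_mod_cast hΔ
  have hL' : (0 : ℚ) < L := by exact_mod_cast hL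
  rw [rangeY, Finset.mem_Icc, le_min_iff, Nat.ceil_le, div_le_iff₀ (by positivity)] at hY
  have hsY : s ≤ Y * (Δb * L) := by exact_mod_cast hY.1
  obtain ⟨Z, rfl⟩ : ∃ Z, Y = Z + 1 := by
    refine Nat.exists_eq_add_one.2 (Nat.pos_of_ne_zero ?_)
    rintro rfl
    omega
  have hZ : Z * Δb < B := by
    have := hY.2.1
    rw [Nat.succ_le_iff, Nat.lt_ceil, lt_div_iff₀ hΔ'] at this
    exact_mod_cast this
  -- For `Δb = B` one pass takes all of `S`, so `Y = 1` and all sets of size `s` count.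
  rcases hΔB.eq_or_lt with rfl | hlt
  · obtain rfl : Z = 0 := by
      by_contra h
      have := Nat.le_mul_of_pos_left Δb (Nat.pos_of_ne_zero h)
      omega
    have : (Finset.univ.filter fun S : Finset (Fin K) =>
        S.card = s ∧ eta slot Δb S = 0 + 1) = Finset.powersetCard s Finset.univ := by
      ext S
      simp only [Finset.mem_filter, Finset.mem_univ, true_and, Finset.mem_powersetCard,
        Finset.subset_univ, and_iff_left_iff_imp]
      intro h
      refine eta_eq_one (b := 0) hΔ hpos (Finset.card_pos.1 (by omega)) fun k _ => ?_
      have := Finset.mem_Icc.1 (hslot k)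
      omega
    rw [this, Finset.card_powersetCard, Finset.card_univ, Fintype.card_fin, q, if_pos rfl]
  · have h := coeff_etaPoly (Δb := Δb) hpos s (Z + 1)
    rw [etaPoly_eq_etaClosed hΔ hslot harr, coeff_etaClosed hL, Nat.sub_zero,
      ← q_eq_of_lt (K := K) hL hΔ hlt hsY hZ] at h
    exact_mod_cast h.symm

/-- The limit of the load as a sum over the encoding sets. -/
theorem sum_eta_eq_loadFormula {K B L N Δb : ℕ} {slot : Fin K → ℕ} (M : ℝ) (hL : 1 ≤ L)
    (hΔ : 1 ≤ Δb) (hΔB : Δb ≤ B) (hslot : ∀ k, slot k ∈ Finset.Icc 1 B)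
    (harr : ∀ b ∈ Finset.Icc 1 B, (arrivals slot b).card = L) :
    ∑ S : Finset (Fin K), (eta slot Δb S : ℝ) *
        ((M / N) ^ (S.card - 1) * (1 - M / N) ^ (K - (S.card - 1))) =
      loadFormula M N K B L Δb := by
  rw [loadFormula, ← Finset.sum_fiberwise_of_maps_to (s := Finset.univ)
    (t := Finset.range (K + 1)) (g := Finset.card) (fun S _ => by
      rw [Finset.mem_range, Nat.lt_succ_iff]
      simpa using Finset.card_le_univ S)]
  -- The class `s = 0` holds only `∅`, for which `eta` vanishes.
  rw [Finset.sum_range_eq_add_Ico _ (Nat.succ_pos K), Finset.sum_eq_zero, zero_add]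
  · change ∑ s ∈ Finset.Icc 1 K, _ = _
    refine Finset.sum_congr rfl fun s hs => ?_
    have hs := Finset.mem_Icc.1 hs
    rw [Finset.sum_congr rfl (g := fun S => (M / N) ^ (s - 1) * (1 - M / N) ^ (K - (s - 1)) *
      (eta slot Δb S : ℝ)) fun S hS => by rw [(Finset.mem_filter.1 hS).2, mul_comm],
      ← Finset.mul_sum]
    congr 1
    rw [← Finset.sum_fiberwise_of_maps_to (t := rangeY B L s Δb) (g := eta slot Δb) (fun S hS => by
      rw [← (Finset.mem_filter.1 hS).2]
      exact eta_mem_rangeY hΔ hL hslot harr S)]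
    refine Finset.sum_congr rfl fun Y hY => ?_
    rw [Finset.sum_congr rfl (g := fun _ => (Y : ℝ))
      fun S hS => by rw [(Finset.mem_filter.1 hS).2], Finset.sum_const, Finset.filter_filter,
      card_filter_eta_eq hL hΔ hΔB hslot harr hs.1 hY, nsmul_eq_mul]
  · intro S hS
    rw [Finset.mem_filter, Finset.card_eq_zero] at hS
    simp [hS.2]


/-! ### Random placement: concentration of the subfile lengths -/

open Filter Topology

section Subsets

variable {F m : ℕ}

theorem card_subsets_disjoint (Q : Finset (Fin F)) :
    (Finset.univ.filter fun A : {A : Finset (Fin F) // A.card = m} => Disjoint A.1 Q).card =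
      (F - Q.card).choose m := by
  have : (F - Q.card).choose m = (Finset.powersetCard m Qᶜ).card := by
    rw [Finset.card_powersetCard, Finset.card_compl, Fintype.card_fin]
  rw [this]
  refine Finset.card_bij (fun A _ => A.1) ?_ ?_ ?_
  · intro A hA
    rw [Finset.mem_filter] at hA
    exact Finset.mem_powersetCard.2 ⟨Finset.subset_compl_iff_disjoint_right.2 hA.2, A.2⟩
  · intro A _ A' _ h
    exact Subtype.ext h
  · intro A hA
    rw [Finset.mem_powersetCard] at hA
    exact ⟨⟨A, hA.2⟩, Finset.mem_filter.2 ⟨Finset.mem_univ _,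
      Finset.subset_compl_iff_disjoint_right.1 hA.1⟩, rfl⟩

theorem card_subsets_superset (hm : m ≤ F) (Q : Finset (Fin F)) :
    (Finset.univ.filter fun A : {A : Finset (Fin F) // A.card = m} => Q ⊆ A.1).card =
      (F - Q.card).choose (F - m) := by
  rw [← card_subsets_disjoint]
  refine Finset.card_bij (fun A _ => ⟨A.1ᶜ, by rw [Finset.card_compl, A.2, Fintype.card_fin]⟩)
    ?_ ?_ ?_
  · intro A hA
    rw [Finset.mem_filter] at hA
    exact Finset.mem_filter.2 ⟨Finset.mem_univ _,
      Finset.disjoint_left.2 fun i hi hi' => Finset.mem_compl.1 hi (hA.2 hi')⟩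
  · intro A _ A' _ h
    exact Subtype.ext (compl_injective (congrArg Subtype.val h))
  · intro A hA
    rw [Finset.mem_filter] at hA
    refine ⟨⟨A.1ᶜ, by rw [Finset.card_compl, A.2, Fintype.card_fin]; omega⟩,
      Finset.mem_filter.2 ⟨Finset.mem_univ _, fun i hi => ?_⟩, Subtype.ext (compl_compl _)⟩
    exact Finset.mem_compl.2 fun hi' => Finset.disjoint_left.1 hA.2 hi' hi

theorem card_subsets (F m : ℕ) :
    Fintype.card {A : Finset (Fin F) // A.card = m} = F.choose m := by
  rw [Fintype.card_finset_len, Fintype.card_fin]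

theorem choose_sub_one_div {r : ℕ} (hr : r ≤ F) (hF : 1 ≤ F) :
    ((F - 1).choose r : ℝ) / F.choose r = 1 - (r : ℝ) / F := by
  obtain ⟨n, rfl⟩ := Nat.exists_eq_add_one.2 hF
  have h0 : ((n + 1).choose r : ℝ) ≠ 0 := by exact_mod_cast (Nat.choose_pos hr).ne'
  have h1 : ((n.choose r * (n + 1) : ℕ) : ℝ) = ((n + 1).choose r * (n + 1 - r) : ℕ) := by
    rw [Nat.choose_mul_succ_eq]
  rw [Nat.add_sub_cancel]
  push_cast [Nat.cast_sub hr] at h1 ⊢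
  have h2 : (n : ℝ) + 1 ≠ 0 := by positivity
  field_simp
  linarith

/-- The form of the second factor makes it visibly tend to the same limit as the first when `r / F`
converges: two bits are asymptotically independent. -/
theorem choose_sub_two_div {r : ℕ} (hr : r ≤ F) (hF : 2 ≤ F) :
    ((F - 2).choose r : ℝ) / F.choose r =
      (1 - (r : ℝ) / F) * ((1 - (r : ℝ) / F - 1 / F) / (1 - 1 / F)) := by
  obtain ⟨n, rfl⟩ := Nat.exists_eq_add_of_le' hF
  rw [Nat.add_sub_cancel]
  have hn1 : (n : ℝ) + 1 ≠ 0 := by positivity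
  have hn2 : (n : ℝ) + 2 ≠ 0 := by positivity
  have hsub : (1 : ℝ) - 1 / (n + 2) ≠ 0 := by
    have : (1 : ℝ) - 1 / (n + 2) = (n + 1) / (n + 2) := by field_simp; ring
    rw [this]
    positivity
  -- For `r = F` the intermediate binomial coefficient is zero and cannot be cancelled.
  rcases hr.eq_or_lt with rfl | hlt
  · rw [Nat.choose_eq_zero_of_lt (by omega), div_self (by positivity)]
    simp
  have h0 : ((n + 1).choose r : ℝ) ≠ 0 := by
    exact_mod_cast (Nat.choose_pos (by omega : r ≤ n + 1)).ne'
  have h1 := choose_sub_one_div (F := n + 2) hr (by omega)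
  have h2 := choose_sub_one_div (F := n + 1) (r := r) (by omega) (by omega)
  rw [show n + 2 - 1 = n + 1 by omega] at h1
  rw [Nat.add_sub_cancel] at h2
  rw [← div_mul_div_cancel₀' h0, h1, h2]
  congr 1
  push_cast
  rw [eq_div_iff hsub]
  field_simp
  ring

end Subsets

theorem placementProb_eq {K N F m : ℕ} (E : Placement K N F m → Prop) [DecidablePred E] :
    placementProb E =
      ((Finset.univ.filter E).card : ℝ) / (Fintype.card (Placement K N F m) : ℝ) := by
  unfold placementProb
  congr!

theorem placementProb_mono {K N F m : ℕ} {E E' : Placement K N F m → Prop} (h : ∀ ω, E ω → E' ω) :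
    placementProb E ≤ placementProb E' := by
  classical
  rw [placementProb_eq, placementProb_eq]
  refine div_le_div_of_nonneg_right ?_ (Nat.cast_nonneg _)
  exact_mod_cast Finset.card_le_card (Finset.monotone_filter_right _ fun ω _ => h ω)

theorem placementProb_exists_le {K N F m : ℕ} {ι : Type*} [Fintype ι]
    (E : ι → Placement K N F m → Prop) :
    placementProb (fun ω => ∃ x, E x ω) ≤ ∑ x, placementProb (E x) := by
  classical
  simp only [placementProb_eq]
  rw [← Finset.sum_div]
  refine div_le_div_of_nonneg_right ?_ (Nat.cast_nonneg _)
  rw [← Nat.cast_sum, Nat.cast_le]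
  refine le_trans (Finset.card_le_card fun ω hω => ?_) Finset.card_biUnion_le
  rw [Finset.mem_filter] at hω
  obtain ⟨x, hx⟩ := hω.2
  exact Finset.mem_biUnion.2 ⟨x, Finset.mem_univ _, Finset.mem_filter.2 ⟨Finset.mem_univ _, hx⟩⟩

open Classical in
/-- The caches of the different F-APs are independent. -/
theorem placementProb_forall {K N F m : ℕ} (hm : m ≤ F) (n : Fin N)
    (Q : Fin K → {A : Finset (Fin F) // A.card = m} → Prop) :
    placementProb (fun ω : Placement K N F m => ∀ j, Q j (ω j n)) =
      ∏ j, ((Finset.univ.filter (Q j)).card : ℝ) / F.choose m := by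
  have h0 : (F.choose m : ℝ) ≠ 0 := by exact_mod_cast (Nat.choose_pos hm).ne'
  have hset : (Finset.univ.filter fun ω : Placement K N F m => ∀ j, Q j (ω j n)) =
      Fintype.piFinset fun j => Fintype.piFinset fun n' =>
        if n' = n then Finset.univ.filter (Q j) else Finset.univ := by
    ext ω
    simp only [Finset.mem_filter, Finset.mem_univ, true_and, Fintype.mem_piFinset]
    refine forall_congr' fun j => ⟨fun h n' => ?_, fun h => ?_⟩
    · split_ifs with hn
      · subst hn
        simpa using h
      · simp
    · simpa using h n
  have hcard : (Fintype.card (Placement K N F m) : ℝ) =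
      ∏ _j : Fin K, ∏ _n' : Fin N, (F.choose m : ℝ) := by
    simp only [Placement, Fintype.card_pi, card_subsets]
    push_cast
    rfl
  rw [placementProb_eq, hset, hcard]
  simp only [Fintype.card_piFinset, Nat.cast_prod]
  rw [← Finset.prod_div_distrib]
  refine Finset.prod_congr rfl fun j _ => ?_
  rw [← Finset.prod_div_distrib, Finset.prod_eq_single n]
  · simp
  · intro n' _ hn
    rw [if_neg hn, Finset.card_univ, card_subsets, div_self h0]
  · intro h
    exact absurd (Finset.mem_univ _) h

/-- The number of bits of file `n` which are cached at the F-APs in `T` and at no others. -/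
def cachedCount {K N F m : ℕ} (n : Fin N) (T : Finset (Fin K)) (ω : Placement K N F m) : ℕ :=
  (Finset.univ.filter fun i : Fin F => ∀ j : Fin K, i ∈ (ω j n).1 ↔ j ∈ T).card

/-- The probability that a bit is cached exactly at the F-APs in `T`, if each F-AP stores a fraction
`x` of the bits. -/
noncomputable def singleProb {K : ℕ} (T : Finset (Fin K)) (x : ℝ) : ℝ :=
  ∏ j, if j ∈ T then x else 1 - x

/-- The probability that two given bits are cached exactly at the F-APs in `T`, if each F-AP stores a
fraction `x` of `1 / u` bits. -/
noncomputable def pairProb {K : ℕ} (T : Finset (Fin K)) (x u : ℝ) : ℝ :=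
  ∏ j, if j ∈ T then x * ((x - u) / (1 - u)) else (1 - x) * ((1 - x - u) / (1 - u))

section Moments

variable {K N F m : ℕ}

/-- The condition factors over the F-APs: the stored set contains `Q` for `j ∈ T` and avoids `Q`
otherwise. Sets `Q` of one and two bits give the first two moments. -/
theorem placementProb_subset (hm : m ≤ F) (n : Fin N) (T : Finset (Fin K)) (Q : Finset (Fin F)) :
    placementProb (fun ω : Placement K N F m => ∀ i ∈ Q, ∀ j, i ∈ (ω j n).1 ↔ j ∈ T) =
      ∏ j, if j ∈ T then ((F - Q.card).choose (F - m) : ℝ) / F.choose m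
        else ((F - Q.card).choose m : ℝ) / F.choose m := by
  classical
  have := placementProb_forall hm n
    (fun (j : Fin K) (A : {A : Finset (Fin F) // A.card = m}) => ∀ i ∈ Q, i ∈ A.1 ↔ j ∈ T)
  have hcomm : (fun ω : Placement K N F m => ∀ i ∈ Q, ∀ j, i ∈ (ω j n).1 ↔ j ∈ T) =
      fun ω => ∀ j, ∀ i ∈ Q, i ∈ (ω j n).1 ↔ j ∈ T := by
    funext ω
    exact propext ⟨fun h j i hi => h i hi j, fun h i hi j => h j i hi⟩
  rw [hcomm, this]
  refine Finset.prod_congr rfl fun j _ => ?_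
  split_ifs with hj
  · rw [← card_subsets_superset hm]
    congr 3
    ext A
    simp [hj, Finset.subset_iff]
  · rw [← card_subsets_disjoint]
    congr 3
    ext A
    simp [hj, Finset.disjoint_right]

theorem placementProb_single (hm : m ≤ F) (n : Fin N) (T : Finset (Fin K)) (i : Fin F) :
    placementProb (fun ω : Placement K N F m => ∀ j, i ∈ (ω j n).1 ↔ j ∈ T) =
      singleProb T (m / F) := by
  have hF : 1 ≤ F := Nat.succ_le_of_lt i.pos
  have hF0 : (F : ℝ) ≠ 0 := by exact_mod_cast (by omega : F ≠ 0)
  have := placementProb_subset hm n T {i}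
  simp only [Finset.mem_singleton, forall_eq, Finset.card_singleton] at this
  rw [this, singleProb]
  refine Finset.prod_congr rfl fun j _ => ?_
  rw [choose_sub_one_div hm hF, ← Nat.choose_symm hm, choose_sub_one_div (Nat.sub_le _ _) hF,
    Nat.cast_sub hm, sub_div, div_self hF0, sub_sub_cancel]

theorem placementProb_pair (hm : m ≤ F) (n : Fin N) (T : Finset (Fin K)) {i i' : Fin F}
    (hi : i ≠ i') :
    placementProb (fun ω : Placement K N F m =>
        (∀ j, i ∈ (ω j n).1 ↔ j ∈ T) ∧ ∀ j, i' ∈ (ω j n).1 ↔ j ∈ T) =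
      pairProb T (m / F) (1 / F) := by
  have hF : 2 ≤ F := by
    have := i.2
    have := i'.2
    have : i.1 ≠ i'.1 := fun h => hi (Fin.ext h)
    omega
  have hF0 : (F : ℝ) ≠ 0 := by exact_mod_cast (by omega : F ≠ 0)
  have := placementProb_subset hm n T {i, i'}
  simp only [Finset.mem_insert, Finset.mem_singleton, forall_eq_or_imp, forall_eq,
    Finset.card_pair hi] at this
  rw [this, pairProb]
  refine Finset.prod_congr rfl fun j _ => ?_
  rw [choose_sub_two_div hm hF, ← Nat.choose_symm hm, choose_sub_two_div (Nat.sub_le _ _) hF,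
    Nat.cast_sub hm, sub_div (F : ℝ), div_self hF0, sub_sub_cancel]

open Classical in
theorem sum_cachedCount (n : Fin N) (T : Finset (Fin K)) (hm : m ≤ F) :
    (∑ ω : Placement K N F m, (cachedCount n T ω : ℝ)) / Fintype.card (Placement K N F m) =
      F * singleProb T (m / F) := by
  simp only [cachedCount, Finset.card_filter, Nat.cast_sum]
  rw [Finset.sum_comm, Finset.sum_div]
  rw [Finset.sum_congr rfl (g := fun _ => singleProb T ((m : ℝ) / F)), Finset.sum_const,
    Finset.card_univ, Fintype.card_fin, nsmul_eq_mul]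
  intro i _
  rw [← placementProb_single hm n T i, placementProb_eq, Finset.card_filter, Nat.cast_sum]

open Classical in
theorem sum_cachedCount_sq (n : Fin N) (T : Finset (Fin K)) (hm : m ≤ F) :
    (∑ ω : Placement K N F m, (cachedCount n T ω : ℝ) ^ 2) / Fintype.card (Placement K N F m) =
      F * singleProb T (m / F) + F * (F - 1) * pairProb T (m / F) (1 / F) := by
  -- Treating the diagonal as a correction to the pair probability gives one formula for all `i,
  -- i'`.
  have hpair : ∀ i i' : Fin F, (∑ ω : Placement K N F m,
      (((if ∀ j, i ∈ (ω j n).1 ↔ j ∈ T then 1 else 0 : ℕ) : ℝ) *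
        ((if ∀ j, i' ∈ (ω j n).1 ↔ j ∈ T then 1 else 0 : ℕ) : ℝ))) /
        Fintype.card (Placement K N F m) =
      pairProb T (m / F) (1 / F) +
        if i = i' then singleProb T (m / F) - pairProb T (m / F) (1 / F) else 0 := by
    intro i i'
    have h : placementProb (fun ω : Placement K N F m =>
        (∀ j, i ∈ (ω j n).1 ↔ j ∈ T) ∧ ∀ j, i' ∈ (ω j n).1 ↔ j ∈ T) =
      pairProb T (m / F) (1 / F) +
        if i = i' then singleProb T (m / F) - pairProb T (m / F) (1 / F) else 0 := by
      split_ifs with hi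
      · subst hi
        simp only [and_self, placementProb_single hm n T i]
        ring
      · rw [placementProb_pair hm n T hi, add_zero]
    rw [← h, placementProb_eq, Finset.card_filter, Nat.cast_sum]
    congr 1
    refine Finset.sum_congr rfl fun ω _ => ?_
    split_ifs <;> simp_all
  simp only [cachedCount, Finset.card_filter, Nat.cast_sum, sq, Finset.sum_mul_sum]
  rw [Finset.sum_comm, Finset.sum_congr rfl fun i _ => Finset.sum_comm, Finset.sum_div]
  rw [Finset.sum_congr rfl fun i _ => (Finset.sum_div _ _ _).trans
    (Finset.sum_congr rfl fun i' _ => hpair i i')]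
  simp only [Finset.sum_add_distrib, Finset.sum_ite_eq, Finset.mem_univ, if_true, Finset.sum_const,
    Finset.card_univ, Fintype.card_fin, nsmul_eq_mul]
  ring

/-- Chebyshev's inequality about an arbitrary centre `F * p`. The mean itself depends on the floor
in `m`, whereas the limit needs a fixed `p`. -/
theorem placementProb_deviation_le (hm : m ≤ F) (hF : 1 ≤ F) (n : Fin N) (T : Finset (Fin K))
    (p : ℝ) {δ : ℝ} (hδ : 0 < δ) :
    placementProb (fun ω : Placement K N F m => δ * F ≤ |(cachedCount n T ω : ℝ) - F * p|) ≤
      (1 / F * singleProb T (m / F) + (1 - 1 / F) * pairProb T (m / F) (1 / F) -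
        2 * p * singleProb T (m / F) + p ^ 2) / δ ^ 2 := by
  classical
  have hF0 : (0 : ℝ) < F := by exact_mod_cast hF
  have hΩ : (0 : ℝ) < Fintype.card (Placement K N F m) := by
    have : 0 < Fintype.card (Placement K N F m) := by
      simp only [Placement, Fintype.card_pi, card_subsets]
      exact Finset.prod_pos fun _ _ => Finset.prod_pos fun _ _ => Nat.choose_pos hm
    exact_mod_cast this
  have h1 := sum_cachedCount n T hm
  have h2 := sum_cachedCount_sq n T hm
  rw [div_eq_iff hΩ.ne'] at h1 h2
  have hsum : ∑ ω : Placement K N F m, ((cachedCount n T ω : ℝ) - F * p) ^ 2 =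
      (F * singleProb T (m / F) + F * (F - 1) * pairProb T (m / F) (1 / F) -
        2 * (F * p) * (F * singleProb T (m / F)) + (F * p) ^ 2) *
        Fintype.card (Placement K N F m) := by
    have : ∀ ω : Placement K N F m, ((cachedCount n T ω : ℝ) - F * p) ^ 2 =
        (cachedCount n T ω : ℝ) ^ 2 - 2 * (F * p) * cachedCount n T ω + (F * p) ^ 2 :=
      fun ω => by ring
    simp only [this, Finset.sum_add_distrib, Finset.sum_sub_distrib, ← Finset.mul_sum, h1, h2,
      Finset.sum_const, Finset.card_univ, nsmul_eq_mul]
    ring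
  have hcheb : ((Finset.univ.filter fun ω : Placement K N F m =>
      δ * F ≤ |(cachedCount n T ω : ℝ) - F * p|).card : ℝ) * (δ * F) ^ 2 ≤
      ∑ ω : Placement K N F m, ((cachedCount n T ω : ℝ) - F * p) ^ 2 := by
    rw [← nsmul_eq_mul, ← Finset.sum_const]
    refine le_trans (Finset.sum_le_sum fun ω hω => ?_)
      (Finset.sum_le_sum_of_subset_of_nonneg (Finset.filter_subset _ _)
        fun ω _ _ => sq_nonneg _)
    rw [← sq_abs ((cachedCount n T ω : ℝ) - F * p)]
    exact pow_le_pow_left₀ (by positivity) (Finset.mem_filter.1 hω).2 2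
  rw [placementProb_eq, div_le_div_iff₀ hΩ (by positivity)]
  rw [hsum] at hcheb
  have hF2 : (0 : ℝ) < F ^ 2 := by positivity
  rw [← mul_le_mul_iff_left₀ hF2]
  refine (le_of_eq ?_).trans (hcheb.trans (le_of_eq ?_))
  · rw [mul_pow, mul_assoc]
  · field_simp

end Moments

theorem singleProb_eq {K : ℕ} (T : Finset (Fin K)) (x : ℝ) :
    singleProb T x = x ^ T.card * (1 - x) ^ (K - T.card) := by
  rw [singleProb, Finset.prod_ite, Finset.prod_const, Finset.prod_const, Finset.filter_not]
  simp [Finset.card_sdiff]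

theorem tendsto_floor_fraction {M : ℝ} {N : ℕ} (hM : 0 ≤ M) :
    Tendsto (fun F : ℕ => ((⌊M * F / N⌋₊ : ℕ) : ℝ) / F) atTop (𝓝 (M / N)) := by
  have := (tendsto_nat_floor_mul_div_atTop (R := ℝ) (a := M / N) (by positivity)).comp
    tendsto_natCast_atTop_atTop
  refine this.congr fun F => ?_
  simp only [Function.comp]
  rw [div_mul_eq_mul_div]

/-- The fraction of the bits of a file cached exactly at the F-APs in `T` converges in
probability. -/
theorem tendsto_placementProb_deviation {K N : ℕ} {M : ℝ} (hM0 : 0 ≤ M) (hMN : M < N) (n : Fin N)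
    (T : Finset (Fin K)) {δ : ℝ} (hδ : 0 < δ) :
    Tendsto (fun F : ℕ => placementProb (fun ω : Placement K N F ⌊M * F / N⌋₊ =>
      δ * F ≤ |(cachedCount n T ω : ℝ) - F * singleProb T (M / N)|)) atTop (𝓝 0) := by
  have hx := tendsto_floor_fraction (N := N) hM0
  have hu : Tendsto (fun F : ℕ => 1 / (F : ℝ)) atTop (𝓝 0) := tendsto_one_div_atTop_nhds_zero_nat
  have hu1 : Tendsto (fun F : ℕ => 1 - 1 / (F : ℝ)) atTop (𝓝 1) := by
    simpa using hu.const_sub 1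
  have hs : Tendsto (fun F : ℕ => singleProb T (((⌊M * F / N⌋₊ : ℕ) : ℝ) / F)) atTop
      (𝓝 (singleProb T (M / N))) := by
    refine tendsto_finsetProd _ fun j _ => ?_
    split_ifs
    · exact hx
    · exact hx.const_sub 1
  have hp : Tendsto (fun F : ℕ => pairProb T (((⌊M * F / N⌋₊ : ℕ) : ℝ) / F) (1 / F)) atTop
      (𝓝 (singleProb T (M / N) ^ 2)) := by
    rw [singleProb, ← Finset.prod_pow]
    refine tendsto_finsetProd _ fun j _ => ?_
    split_ifs
    · simpa [sq] using hx.mul ((hx.sub hu).div hu1 one_ne_zero)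
    · simpa [sq] using (hx.const_sub 1).mul (((hx.const_sub 1).sub hu).div hu1 one_ne_zero)
  have hlim := ((((hu.mul hs).add (hu1.mul hp)).sub (hs.const_mul (2 * singleProb T (M / N)))).add
    (tendsto_const_nhds (x := singleProb T (M / N) ^ 2))).div_const (δ ^ 2)
  -- With `p` the limiting probability, the normalized second moment about `p` tends to `p² - 2p² +
  -- p² = 0`.
  have hzero : (0 * singleProb T (M / N) + 1 * singleProb T (M / N) ^ 2 -
      2 * singleProb T (M / N) * singleProb T (M / N) + singleProb T (M / N) ^ 2) / δ ^ 2 = 0 := by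
    ring
  rw [hzero] at hlim
  refine squeeze_zero' (Eventually.of_forall fun F => ?_) ?_ hlim
  · unfold placementProb
    positivity
  · filter_upwards [eventually_ge_atTop 1] with F hF
    refine placementProb_deviation_le ?_ hF n T _ hδ
    refine Nat.floor_le_of_le ?_
    have hN : (0 : ℝ) < N := hM0.trans_lt hMN
    rw [div_le_iff₀ hN, mul_comm]
    gcongr


/-! ### Combining the load estimate with concentration -/

theorem abs_load_div_sub_lt {K N B L Δb F m : ℕ} {M ε δ : ℝ} {slot : Fin K → ℕ}
    (hL : 1 ≤ L) (hΔ1 : 1 ≤ Δb) (hΔB : Δb ≤ B) (hslot : ∀ k, slot k ∈ Finset.Icc 1 B)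
    (harr : ∀ b ∈ Finset.Icc 1 B, (arrivals slot b).card = L) (hF : 1 ≤ F)
    (hδ : ∀ T : Finset (Fin K), δ ≤ singleProb T (M / N))
    (hδε : (∑ S, (eta slot Δb S : ℝ)) * δ < ε) (ω : Placement K N F m)
    (hω : ∀ n T, |(cachedCount n T ω : ℝ) - F * singleProb T (M / N)| < δ * F)
    (d : Fin K → Fin N) (W : Fin N → Fin F → Bool) :
    |((Delivery.mk B Δb slot (fun k n => (ω k n).1) d W).load : ℝ) / F -
      loadFormula M N K B L Δb| < ε := by
  have hF0 : (0 : ℝ) < F := by exact_mod_cast hF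
  set D := Delivery.mk B Δb slot (fun k n => (ω k n).1) d W with hD
  have hlen : ∀ k T, (D.subfile k T).length = cachedCount (d k) T ω :=
    fun k T => D.length_subfile k T
  have h := D.abs_load_sub_le (fun k => (Finset.mem_Icc.1 (hslot k)).1)
    (fun k => (Finset.mem_Icc.1 (hslot k)).2) hΔ1 hΔB (δ := δ * F)
    (fun t => F * ((M / N) ^ t * (1 - M / N) ^ (K - t)))
    (fun k T _ => by
      rw [hlen, ← singleProb_eq]
      exact (hω _ _).le)
    -- Since `δ ≤ singleProb T (M / N)`, the strict deviation bound forces a positive count, so no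
    -- initially empty subfile can block a message.
    (fun k T _ => by
      rw [← List.length_pos_iff, hlen]
      have h1 := (abs_lt.1 (hω (d k) T)).1
      have h2 := mul_le_mul_of_nonneg_left (hδ T) hF0.le
      have h3 : (0 : ℝ) < cachedCount (d k) T ω := by linarith
      exact_mod_cast h3)
  have hsum : ∑ S, (eta D.slot D.Δb S : ℝ) *
      (F * ((M / N) ^ (S.card - 1) * (1 - M / N) ^ (K - (S.card - 1)))) =
      F * loadFormula M N K B L Δb := by
    rw [← sum_eta_eq_loadFormula M hL hΔ1 hΔB hslot harr, Finset.mul_sum]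
    exact Finset.sum_congr rfl fun S _ => mul_left_comm _ _ _
  rw [hsum, ← Finset.sum_mul, ← mul_assoc] at h
  have h4 : |(D.load : ℝ) - F * loadFormula M N K B L Δb| < ε * F :=
    h.trans_lt (mul_lt_mul_of_pos_right hδε hF0)
  have h5 : (D.load : ℝ) / F - loadFormula M N K B L Δb =
      ((D.load : ℝ) - F * loadFormula M N K B L Δb) / F := by
    field_simp
  rwa [h5, abs_div, abs_of_pos hF0, div_lt_iff₀ hF0]

end AsyncCaching

theorem theorem1 (K N B L Δb : ℕ) (M : ℝ) (slot : Fin K → ℕ)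
    (hNK : K ≤ N) (hM0 : 0 < M) (hMN : M < N)
    (hB : 3 ≤ B) (hL : 1 ≤ L) (hΔ1 : 1 ≤ Δb) (hΔB : Δb ≤ B)
    (hslot : ∀ k, slot k ∈ Finset.Icc 1 B)
    (harr : ∀ b ∈ Finset.Icc 1 B, (AsyncCaching.arrivals slot b).card = L) :
    (∀ s ∈ Finset.Icc 1 K, ∀ Y ∈ AsyncCaching.rangeY B L s Δb,
      (Finset.univ.filter fun S : Finset (Fin K) =>
        S.card = s ∧ AsyncCaching.eta slot Δb S = Y).card = AsyncCaching.q K B L s Y Δb) ∧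
    ∀ ε : ℝ, 0 < ε →
      Filter.Tendsto
        (fun F : ℕ => AsyncCaching.placementProb
          (fun ω : AsyncCaching.Placement K N F ⌊M * F / N⌋₊ =>
            ∃ (d : Fin K → Fin N) (W : Fin N → Fin F → Bool),
              ε ≤ |((AsyncCaching.Delivery.mk B Δb slot (fun k n => (ω k n).1) d W).load : ℝ) / F
                - AsyncCaching.loadFormula M N K B L Δb|))
        Filter.atTop (nhds 0) := by
  refine ⟨fun s hs Y hY => AsyncCaching.card_filter_eta_eq hL hΔ1 hΔB hslot harr
    (Finset.mem_Icc.1 hs).1 hY, fun ε hε => ?_⟩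
  have hN : (0 : ℝ) < N := hM0.trans hMN
  have hp0 : 0 < M / N := div_pos hM0 hN
  have hp1 : 0 < 1 - M / N := sub_pos.2 ((div_lt_one hN).2 hMN)
  have hpos : ∀ T : Finset (Fin K), 0 < AsyncCaching.singleProb T (M / N) := fun T => by
    rw [AsyncCaching.singleProb_eq]
    positivity
  obtain ⟨T₀, -, hT₀⟩ := Finset.exists_min_image Finset.univ
    (fun T : Finset (Fin K) => AsyncCaching.singleProb T (M / N)) Finset.univ_nonempty
  set H : ℝ := ∑ S, (AsyncCaching.eta slot Δb S : ℝ) with hH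
  have hH0 : 0 ≤ H := Finset.sum_nonneg fun _ _ => Nat.cast_nonneg _
  -- The first bound keeps all subfiles nonempty. The second gives `H * δ ≤ ε - δ < ε`, also when `H
  -- = 0`.
  set δ : ℝ := min (AsyncCaching.singleProb T₀ (M / N)) (ε / (H + 1)) with hδdef
  have hδ : 0 < δ := lt_min (hpos T₀) (by positivity)
  have hδε : H * δ < ε := by
    have h1 : δ * (H + 1) ≤ ε := (le_div_iff₀ (by positivity)).1 (min_le_right _ _)
    linarith
  -- The number of bad events does not depend on `F`, so the union bound still tends to zero.
  have hlim := tendsto_finsetSum (Finset.univ : Finset (Fin N × Finset (Fin K))) fun x _ =>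
    AsyncCaching.tendsto_placementProb_deviation hM0.le hMN x.1 x.2 hδ
  rw [Finset.sum_const_zero] at hlim
  refine squeeze_zero' (Filter.Eventually.of_forall fun F => ?_) ?_ hlim
  · unfold AsyncCaching.placementProb
    positivity
  · filter_upwards [Filter.eventually_ge_atTop 1] with F hF
    refine (AsyncCaching.placementProb_mono fun ω => ?_).trans
      (AsyncCaching.placementProb_exists_le _)
    rintro ⟨d, W, hdW⟩
    by_contra hcon
    push Not at hcon
    exact absurd hdW (not_le.2 (AsyncCaching.abs_load_div_sub_lt hL hΔ1 hΔB hslot harr hF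
      (fun T => (min_le_left _ _).trans (hT₀ T (Finset.mem_univ T))) hδε ω
      (fun n T => hcon (n, T)) d W))
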